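/- **Setting.** Let $G=(V,E)$ be a finite simple graph without isolated vertices, $n=|V|$, $d(y)$ the degree of $y$, $\mu(S)=\sum_{y\in S}d(y)$, $\partial(S)$ the number of edges between $S$ and $V\setminus S$, and $\phi(S)=\partial(S)/\mu(S)$. Let $p(y,z)$ be the lazy walk kernel ($1/2$ if $y=z$, $1/(2d(y))$ if $\{y,z\}\in E$, $0$ otherwise) and $p(y,S)=\sum_{z\in S}p(y,z)$. The evolving set process moves from $S$ to $\{y: p(y,S)\ge U\}$ with $U$ uniform on $[0,1]$; let $\mathbf K$ be its kernel. The volume-biased evolving set process has the kernel $\widehat{\mathbf K}(S,S')=\frac{\mu(S')}{\mu(S)}\mathbf K(S,S')$, and $\widehat{\mathbf P}_x[S_0,\dots,S_t]=\prod_{j<t}\widehat{\mathbf K}(S_j,S_{j+1})$ for $S_0=\{x\}$. Put $$\mathrm{cost}(S_0,\dots,S_t)=\mu(S_0)+\sum_{j=1}^t\big(\mu(S_j\,\Delta\,S_{j-1})+\partial(S_{j-1})\big),\qquad \theta_T=\sqrt{4T^{-1}\log\mu(V)},$$ and let $\tau=\tau(T,B)$ be the first $t$ with $\phi(S_t)<\theta_T$,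 or $t=T$, or $\mathrm{cost}(S_0,\dots,S_t)>B$ (if $T=0$, then $\tau=0$). **Algorithm.** $\mathtt{GenerateSample}(x,T,B)$ stops at once with the output $\{x\}$ if $\tau=0$. Otherwise it keeps the current set $S$ in a set-with-boundary data structure made of two red-black tree dictionaries (the members of $S$; the vertices $y$ of the two-sided vertex boundary $\delta(S)$, consisting of the endpoints of the edges between $S$ and $V\setminus S$, each with the number of its neighbors in $S$), and a vertex $X$, initially $S_0=\{x\}$ and $X=x$. In step $t$ it moves $X$ by one step of the lazy walk, draws $Z$ uniformly from $[0,p(X,S_{t-1})]$, so that $S_t=\{y: p(y,S_{t-1})\ge Z\}$, and lists $S_t\,\Delta\,S_{t-1}$ by looking up $p(y,S_{t-1})$ for every $y\in\delta(S_{t-1})$. If $t=T$ or $\mathrm{cost}(S_0,\dots,S_t)>B$, it outputs $S_t$ without updating the boundary dictionary; otherwise it updates the data structure to $S_t$, and it outputs $S_t$ if $\phi(S_t)<\theta_T$. Time is counted in elementary steps: bounded-size operations on vertices, integers, reals and tree nodes, a degree query, a query for $\mu(V)$, a uniformly random neighbor, a fair coin and a uniform real number cost $1$ each, and a list of the neighbors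 of $y$ costs $1+d(y)$. **Theorem.** There is an absolute constant $C>0$ such that for every such graph $G$, every vertex $x$ and all integers $T,B\ge 0$ the following holds. 1. For every sequence of sets with $S_0=\{x\}$ and $\tau=\tau(T,B)$, the probability that $\mathtt{GenerateSample}(x,T,B)$ generates the sample path $(S_0,\dots,S_\tau)$ is $\widehat{\mathbf P}_x[S_0,\dots,S_\tau]$. 2. With probability $1$ the generated path is of the form $(S_0,\dots,S_\tau)$ with $S_0=\{x\}$ and $\tau=\tau(T,B)$, the output is $S_\tau$, and the running time is at most $$C\,\log n\cdot\min\big(\max(1,B),\ \mathrm{cost}(S_0,\dots,S_\tau)\big).$$ -/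

import Mathlib

/-! # The volume-biased evolving set process and the algorithm `GenerateSample` -/

namespace EvoSet

open MeasureTheory RBTree

noncomputable section

/-! ## Graphs, the lazy walk, evolving sets -/

section Chain

variable {V : Type} [Fintype V] [DecidableEq V] (G : SimpleGraph V) [DecidableRel G.Adj]

/-- The volume `μ(S)`. -/
def vol (S : Finset V) : ℕ := ∑ y ∈ S, G.degree y

/-- The edge boundary `∂(S) = e(S, Sᶜ)`. -/
def cut (S : Finset V) : ℕ := (G.interedges S Sᶜ).card

/-- The conductance `φ(S) = ∂(S) / μ(S)`. -/
def conductance (S : Finset V) : ℝ := (cut G S : ℝ) / (vol G S : ℝ)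

/-- The transition kernel `p(y, z)` of the lazy random walk. -/
def walk (y z : V) : ℝ :=
  if G.Adj y z then 1 / (2 * (G.degree y : ℝ)) else if y = z then 1 / 2 else 0

/-- `p(y, S)`, the probability that the walk moves from `y` into `S`. -/
def walkInto (y : V) (S : Finset V) : ℝ := ∑ z ∈ S, walk G y z

/-- The successor of `S` in the evolving set process for the threshold `u`. -/
def evolve (S : Finset V) (u : ℝ) : Finset V := {y | u ≤ walkInto G y S}

/-- The kernel `K(S, S')` of the evolving set process: the threshold is uniform on `[0, 1]`. -/
def espKernel (S S' : Finset V) : ℝ :=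
  volume.real {u : ℝ | u ∈ Set.Icc (0 : ℝ) 1 ∧ evolve G S u = S'}

/-- The kernel of the volume-biased evolving set process. -/
def biasedKernel (S S' : Finset V) : ℝ :=
  (vol G S' : ℝ) / (vol G S : ℝ) * espKernel G S S'

/-- The probability that the volume-biased evolving set process, started from `S 0`, begins with
the states `S 0, …, S t`. -/
def biasedPathProb (S : ℕ → Finset V) (t : ℕ) : ℝ :=
  ∏ j ∈ Finset.range t, biasedKernel G (S j) (S (j + 1))

/-- The cost of the path `S 0, …, S t`. -/
def cost (S : ℕ → Finset V) (t : ℕ) : ℕ :=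
  vol G (S 0) + ∑ j ∈ Finset.range t, (vol G (symmDiff (S (j + 1)) (S j)) + cut G (S j))

/-- `θ_T = √(4 T⁻¹ log μ(V))`. -/
def theta (T : ℕ) : ℝ := √(4 * (T : ℝ)⁻¹ * Real.log (vol G Finset.univ))

/-- The stopping time `τ(T, B)` of a trajectory. The set below always contains `T`. -/
def tau (T B : ℕ) (S : ℕ → Finset V) : ℕ :=
  sInf {t | conductance G (S t) < theta G T ∨ t = T ∨ B < cost G S t}

end Chain

/-! ## Randomized programs with a step count -/

/-- Randomized programs that access the graph only through queries. Every constructor but `ret` is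
one instruction, followed by the rest of the program as a function of the answer. -/
inductive Prog (V α : Type) : Type
  /-- Halt with a result. -/
  | ret (a : α) : Prog V α
  /-- One elementary step: a comparison of two vertices, an arithmetic expression of bounded size
  in integers and reals, or reading and building a bounded number of list cells, tree nodes or
  records. -/
  | work (next : Prog V α) : Prog V α
  /-- Ask for the volume of the whole vertex set. -/
  | totalVolume (next : ℕ → Prog V α) : Prog V α
  /-- Ask for the degree of `v`. -/
  | degree (v : V) (next : ℕ → Prog V α) : Prog V α
  /-- Ask for a list of the neighbors of `v`. -/
  | neighbors (v : V) (next : List V → Prog V α) : Prog V α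
  /-- Ask for a uniformly random neighbor of `v`. -/
  | randomNeighbor (v : V) (next : V → Prog V α) : Prog V α
  /-- Toss a fair coin. -/
  | coin (next : Bool → Prog V α) : Prog V α
  /-- Draw a real number uniformly from the interval `[0, a]`. -/
  | uniform (a : ℝ) (next : ℝ → Prog V α) : Prog V α

namespace Prog

/-- Sequential composition. -/
def bind {V α β : Type} : Prog V α → (α → Prog V β) → Prog V β
  | ret a, f => f a
  | work k, f => work (k.bind f)
  | totalVolume k, f => totalVolume fun m => (k m).bind f
  | degree v k, f => degree v fun d => (k d).bind f
  | neighbors v k, f => neighbors v fun l => (k l).bind f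
  | randomNeighbor v k, f => randomNeighbor v fun u => (k u).bind f
  | coin k, f => coin fun b => (k b).bind f
  | uniform a k, f => uniform a fun z => (k z).bind f

instance {V : Type} : Monad (Prog V) where
  pure := Prog.ret
  bind := Prog.bind

/-- One elementary step that produces `a`. -/
def op {V α : Type} (a : α) : Prog V α := work (ret a)

end Prog

/-- What can be seen of a run: the result and the number of time units spent. -/
structure Run (α : Type) where
  result : α
  time : ℕ

instance {α : Type} : MeasurableSpace (Run α) := ⊤

/-- Charge `c` further time units. -/
def Run.charge {α : Type} (c : ℕ) (r : Run α) : Run α := ⟨r.result, c + r.time⟩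

/-- The joint distribution of the result and the running time of a program on the graph `G`.
Listing the neighbors of `v` takes time `1 + d(v)`, every other instruction takes time `1`. -/
def Prog.law {V α : Type} [Fintype V] [DecidableEq V] (G : SimpleGraph V) [DecidableRel G.Adj] :
    Prog V α → Measure (Run α)
  | .ret a => Measure.dirac ⟨a, 0⟩
  | .work k => (k.law G).map (Run.charge 1)
  | .totalVolume k => ((k (vol G Finset.univ)).law G).map (Run.charge 1)
  | .degree v k => ((k (G.degree v)).law G).map (Run.charge 1)
  | .neighbors v k =>
      ((k (G.neighborFinset v).toList).law G).map (Run.charge (1 + G.degree v))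
  | .randomNeighbor v k =>
      (∑ u ∈ G.neighborFinset v, (G.degree v : ENNReal)⁻¹ • (k u).law G).map (Run.charge 1)
  | .coin k =>
      ((2 : ENNReal)⁻¹ • (k true).law G + (2 : ENNReal)⁻¹ • (k false).law G).map (Run.charge 1)
  | .uniform a k =>
      ((ProbabilityTheory.cond volume (Set.Icc (0 : ℝ) a)).bind fun z => (k z).law G).map
        (Run.charge 1)

open Prog (op)

/-! ## Dictionaries: red-black trees whose nodes hold a vertex and a value -/

section Dictionary

variable {V : Type} [LinearOrder V] {β : Type}

/-- A dictionary. -/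
abbrev Dict (V β : Type) : Type := RBNode (V × β)

/-- Look up the value stored under the key `y`. -/
def lookup (y : V) : Dict V β → Prog V (Option β)
  | .nil => op none
  | .node _ l e r => do
    match ← op (compare y e.1) with
    | .lt => lookup y l
    | .gt => lookup y r
    | .eq => op (some e.2)

/-- The recursive part of `insert`. The functions `balance1` and `balance2` inspect and rebuild at
most four nodes. -/
def insertRec (y : V) (b : β) : Dict V β → Prog V (Dict V β)
  | .nil => op (.node .red .nil (y, b) .nil)
  | .node .red l e r => do
    match ← op (compare y e.1) with
    | .lt => do
      let l' ← insertRec y b l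
      op (.node .red l' e r)
    | .gt => do
      let r' ← insertRec y b r
      op (.node .red l e r')
    | .eq => op (.node .red l (y, b) r)
  | .node .black l e r => do
    match ← op (compare y e.1) with
    | .lt => do
      let l' ← insertRec y b l
      op (RBNode.balance1 l' e r)
    | .gt => do
      let r' ← insertRec y b r
      op (RBNode.balance2 l e r')
    | .eq => op (.node .black l (y, b) r)

/-- Store the value `b` under the key `y`. -/
def insert (y : V) (b : β) (t : Dict V β) : Prog V (Dict V β) := do
  match ← op t.isRed with
  | .red => do
    let t' ← insertRec y b t
    op t'.setBlack
  | .black => insertRec y b t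

/-- Concatenate two trees of the same black-height. The function `balLeft` inspects and rebuilds a
bounded number of nodes. -/
def join : Dict V β → Dict V β → Prog V (Dict V β)
  | .nil, t => op t
  | s, .nil => op s
  | .node .red a x b, .node .red c y d => do
    match ← join b c with
    | .node .red b₁ z c₁ => op (.node .red (.node .red a x b₁) z (.node .red c₁ y d))
    | bc => op (.node .red a x (.node .red bc y d))
  | .node .black a x b, .node .black c y d => do
    match ← join b c with
    | .node .red b₁ z c₁ => op (.node .red (.node .black a x b₁) z (.node .black c₁ y d))
    | bc => op (RBNode.balLeft a x (.node .black bc y d))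
  | .node .black a x b, .node .red c y d => do
    let s ← join (.node .black a x b) c
    op (.node .red s y d)
  | .node .red a x b, .node .black c y d => do
    let s ← join b (.node .black c y d)
    op (.node .red a x s)
termination_by s t => s.size + t.size

/-- The recursive part of `erase`. The functions `balLeft` and `balRight` inspect and rebuild a
bounded number of nodes. -/
def eraseRec (y : V) : Dict V β → Prog V (Dict V β)
  | .nil => op .nil
  | .node _ l e r => do
    match ← op (compare y e.1) with
    | .lt => do
      let l' ← eraseRec y l
      match l.isBlack with
      | .black => op (RBNode.balLeft l' e r)
      | .red => op (.node .red l' e r)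
    | .gt => do
      let r' ← eraseRec y r
      match r.isBlack with
      | .black => op (RBNode.balRight l e r')
      | .red => op (.node .red l e r')
    | .eq => join l r

/-- Delete the key `y`. -/
def erase (y : V) (t : Dict V β) : Prog V (Dict V β) := do
  let t' ← eraseRec y t
  op t'.setBlack

/-- The entries of a dictionary in front of a list. -/
def entriesRec : Dict V β → List (V × β) → Prog V (List (V × β))
  | .nil, acc => op acc
  | .node _ l e r, acc => do
    let acc₁ ← entriesRec r acc
    let acc₂ ← op (e :: acc₁)
    entriesRec l acc₂

/-- Iterate over a dictionary. -/
def entries (t : Dict V β) : Prog V (List (V × β)) := entriesRec t []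

end Dictionary

/-! ## The set-with-boundary data structure -/

/-- A set `S` of vertices with its two-sided vertex boundary. -/
structure BoundarySet (V : Type) where
  /-- The vertices in `S`. -/
  members : Dict V Unit
  /-- The vertices `y` in the two-sided boundary of `S`, each with the value `e(y, S)`. -/
  boundary : Dict V ℕ
  /-- The value `∂(S)`. -/
  cutSize : ℕ

namespace BoundarySet

variable {V : Type} [LinearOrder V]

/-- Is `y` in `S`? -/
def mem (S : BoundarySet V) (y : V) : Prog V Bool := do
  let o ← lookup y S.members
  op o.isSome

/-- The value `e(y, S)`. -/
def edges (S : BoundarySet V) (y : V) : Prog V ℕ := do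
  match ← lookup y S.boundary with
  | some e => op e
  | none => do
    let inS ← S.mem y
    if inS then Prog.degree y op else op 0

/-- The value `p(y, S)`. -/
def prob (S : BoundarySet V) (y : V) : Prog V ℝ := do
  let e ← S.edges y
  let inS ← S.mem y
  let d ← Prog.degree y op
  op (((e : ℝ) / (d : ℝ) + if inS then 1 else 0) / 2)

/-- Set the value `e(z, S)` to `e` and put `z` in or out of the boundary dictionary. -/
def record (S : BoundarySet V) (z : V) (e : ℕ) : Prog V (BoundarySet V) := do
  let inS ← S.mem z
  let d ← Prog.degree z op
  let onBoundary ← op (if inS then decide (e < d) else decide (0 < e))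
  if onBoundary then do
    let b ← insert z e S.boundary
    op { S with boundary := b }
  else do
    let b ← erase z S.boundary
    op { S with boundary := b }

/-- For every `z` in a list increment (`up = true`) or decrement `e(z, S)`. -/
def shift (up : Bool) : List V → BoundarySet V → Prog V (BoundarySet V)
  | [], S => op S
  | z :: zs, S => do
    let e ← S.edges z
    let e' ← op (if up then e + 1 else e - 1)
    let S' ← S.record z e'
    shift up zs S'

/-- Add `y` to `S` if it is not in `S`, remove it if it is. -/
def toggle (S : BoundarySet V) (y : V) : Prog V (BoundarySet V) := do
  let inS ← S.mem y
  let e ← S.edges y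
  let d ← Prog.degree y op
  let c ← op (if inS then S.cutSize + 2 * e - d else S.cutSize + d - 2 * e)
  let M ← if inS then erase y S.members else insert y () S.members
  let S₁ ← op (⟨M, S.boundary, c⟩ : BoundarySet V)
  let S₂ ← S₁.record y e
  let N ← Prog.neighbors y op
  shift (!inS) N S₂

/-- Toggle every vertex of a list. -/
def toggleAll : List V → BoundarySet V → Prog V (BoundarySet V)
  | [], S => op S
  | y :: D, S => do
    let S' ← S.toggle y
    toggleAll D S'

end BoundarySet

/-! ## GenerateSample -/

/-- The result of `GenerateSample`: the generated path `S_0, …, S_τ`, and the output. The path is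
kept only in order to speak about it: no instruction depends on it, and keeping it is not
charged. -/
structure Sample (V : Type) where
  path : List (Finset V)
  output : List V

/-- The vertices stored in a membership dictionary, as a list. -/
def keys {V : Type} : List (V × Unit) → Prog V (List V)
  | [] => op []
  | e :: es => do
    let l ← keys es
    op (e.1 :: l)

/-- Output the contents of a membership dictionary. -/
def finish {V : Type} (path : List (Finset V)) (M : Dict V Unit) : Prog V (Sample V) := do
  let es ← entries M
  let l ← keys es
  op ⟨path, l⟩

section Algorithm

variable {V : Type} [LinearOrder V]

/-- Toggle every vertex of a list in the membership dictionary alone. -/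
def toggleMembers : List V → Dict V Unit → Prog V (Dict V Unit)
  | [], M => op M
  | y :: D, M => do
    match ← lookup y M with
    | some _ => do
      let M' ← erase y M
      toggleMembers D M'
    | none => do
      let M' ← insert y () M
      toggleMembers D M'

/-- One step of the lazy random walk. -/
def walkStep (y : V) : Prog V V := do
  let stay ← Prog.coin op
  if stay then op y else Prog.randomNeighbor y op

/-- Go through the boundary of `S = S_{t-1}` and find the vertices of `S_t Δ S_{t-1}`, where `S_t`
belongs to the threshold `Z`. The three values carried along are the list `D` found so far, the
volume of `S_{t-1} Δ D`, and the cost. -/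
def select (S : BoundarySet V) (Z : ℝ) :
    List (V × ℕ) → List V → ℕ → ℕ → Prog V (List V × ℕ × ℕ)
  | [], D, m, c => op (D, m, c)
  | (y, _) :: rest, D, m, c => do
    let p ← S.prob y
    let inS ← S.mem y
    let inNew ← op (decide (Z ≤ p))
    if inNew = inS then select S Z rest D m c
    else do
      let d ← Prog.degree y op
      let m' ← op (if inS then m - d else m + d)
      let c' ← op (c + d)
      let D' ← op (y :: D)
      select S Z rest D' m' c'

/-- The steps of the algorithm. The first argument after `B` is the number of steps left until
time `T`; `S`, `X`, `m`, `c` are the current set `S_{t-1}`, the walk particle, the volume of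
`S_{t-1}`, and the cost of the path so far. `Sset` is the set `S_{t-1}` and `path` the list
`S_0, …, S_{t-1}`; both are only recorded. -/
def steps (θ : ℝ) (B : ℕ) :
    ℕ → BoundarySet V → V → ℕ → ℕ → Finset V → List (Finset V) → Prog V (Sample V)
  | 0, S, _, _, _, _, path => finish path S.members
  | left + 1, S, X, m, c, Sset, path => do
    let X' ← walkStep X
    let q ← S.prob X'
    let Z ← Prog.uniform q op
    let δ ← entries S.boundary
    let c₀ ← op (c + S.cutSize)
    let (D, m', c') ← select S Z δ [] m c₀
    let Sset' := symmDiff Sset D.toFinset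
    let path' := path ++ [Sset']
    let halt ← op (decide (left = 0) || decide (B < c'))
    if halt then do
      let M ← toggleMembers D S.members
      finish path' M
    else do
      let S' ← BoundarySet.toggleAll D S
      let small ← op (decide ((S'.cutSize : ℝ) / (m' : ℝ) < θ))
      if small then finish path' S'.members
      else steps θ B left S' X' m' c' Sset' path'

/-- `GenerateSample(x, T, B)`. The conditions that define `τ` are tested at time `0` before the
data structure is set up; the set `{x}` has volume `d(x)` and boundary `d(x)`. -/
def generateSample (x : V) (T B : ℕ) : Prog V (Sample V) := do
  let d ← Prog.degree x op
  let m ← Prog.totalVolume op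
  let θ ← op √(4 * (T : ℝ)⁻¹ * Real.log m)
  let halt ← op (decide ((d : ℝ) / (d : ℝ) < θ) || decide (T = 0) || decide (B < d))
  if halt then op ⟨[{x}], [x]⟩
  else do
    let S ← BoundarySet.toggle ⟨.nil, .nil, 0⟩ x
    steps θ B T S x d d {x} [{x}]

end Algorithm

end

end EvoSet

/-! Distribution. The walk particle and the evolving set are coupled so that, given the sets, the
particle sits at a vertex of the current set with probability proportional to its degree. Put weight
d(X) on each X in S. By reversibility a walk step carries weight d(X') p(X', S) to X'. A threshold
uniform on [0, p(X', S)] then selects a successor N with probability K(S, N) / p(X', S) if X' lies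
in N, and 0 otherwise. The factor p(X', S) cancels: weight d(X') K(S, N) is left at each X' in N,
which is again proportional to the degree and has total μ(N) K(S, N), that is, μ(S) times the biased
kernel. This is `sum_degree_mul_step`, and `StoresBoundary.sum_resultProb_steps` iterates it along
the path. Since the start {x} is a single vertex, the average there has one term.

Time. A red-black tree of vertices has depth at most H = O(log n). A step scans the boundary in time
O(H ∂(S)) and updates the data structure in time proportional to H times the volume of the symmetric
difference, so every step but the last is paid for by the cost that it adds. Constant overheads are
absorbed because ∂(S) ≥ 1 as long as φ(S) is at least a positive θ. A last step that runs out of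
time or budget may have a symmetric difference of huge volume, but it touches only the membership
dictionary: it changes at most 2∂(S) entries and outputs at most μ(S) + 2∂(S) vertices, both bounded
by the cost before the step, which is at most B. See `StoresBoundary.exists_reduces_afterDraw` and
`StoresBoundary.outcome_steps`.

Programs are read in two ways. Facts that hold on every run are proved for the inductively defined
outcomes and passed on to the law by `ae_outcome`. Probabilities are computed from the law itself;
measurability in the threshold holds because only finitely many successor sets occur. -/

namespace EvoSet

open MeasureTheory RBTree

/-! ## Deterministic reductions and possible outcomes of programs -/

section Semantics

variable {V α β : Type} [Fintype V] (G : SimpleGraph V) [DecidableRel G.Adj]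

/-- The program `p` performs instructions without randomness of total cost `c` and continues
as `q`. -/
inductive Reduces : Prog V α → ℕ → Prog V α → Prop
  | refl (p : Prog V α) : Reduces p 0 p
  | work {k q : Prog V α} {c : ℕ} (h : Reduces k c q) : Reduces (.work k) (1 + c) q
  | totalVolume {k : ℕ → Prog V α} {q : Prog V α} {c : ℕ}
      (h : Reduces (k (vol G Finset.univ)) c q) : Reduces (.totalVolume k) (1 + c) q
  | degree {v : V} {k : ℕ → Prog V α} {q : Prog V α} {c : ℕ}
      (h : Reduces (k (G.degree v)) c q) : Reduces (.degree v k) (1 + c) q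
  | neighbors {v : V} {k : List V → Prog V α} {q : Prog V α} {c : ℕ}
      (h : Reduces (k (G.neighborFinset v).toList) c q) :
      Reduces (.neighbors v k) (1 + G.degree v + c) q

/-- The program `p` computes `a` without randomness in time at most `N`. -/
def Computes (p : Prog V α) (a : α) (N : ℕ) : Prop := ∃ c ≤ N, Reduces G p c (.ret a)

/-- A run that the program can perform on `G`. -/
inductive Outcome : Prog V α → Run α → Prop
  | ret (a : α) : Outcome (.ret a) ⟨a, 0⟩
  | work {k : Prog V α} {r : Run α} (h : Outcome k r) : Outcome (.work k) (r.charge 1)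
  | totalVolume {k : ℕ → Prog V α} {r : Run α} (h : Outcome (k (vol G Finset.univ)) r) :
      Outcome (.totalVolume k) (r.charge 1)
  | degree {v : V} {k : ℕ → Prog V α} {r : Run α} (h : Outcome (k (G.degree v)) r) :
      Outcome (.degree v k) (r.charge 1)
  | neighbors {v : V} {k : List V → Prog V α} {r : Run α}
      (h : Outcome (k (G.neighborFinset v).toList) r) :
      Outcome (.neighbors v k) (r.charge (1 + G.degree v))
  | randomNeighbor {v u : V} {k : V → Prog V α} {r : Run α} (hu : u ∈ G.neighborFinset v)
      (h : Outcome (k u) r) : Outcome (.randomNeighbor v k) (r.charge 1)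
  | coin {k : Bool → Prog V α} {r : Run α} (b : Bool) (h : Outcome (k b) r) :
      Outcome (.coin k) (r.charge 1)
  | uniform {a z : ℝ} {k : ℝ → Prog V α} {r : Run α} (hz : z ∈ Set.Icc 0 a)
      (h : Outcome (k z) r) : Outcome (.uniform a k) (r.charge 1)

variable {G}

theorem Run.charge_charge (c d : ℕ) (r : Run α) : (r.charge d).charge c = r.charge (c + d) := by
  simp [Run.charge, add_assoc]

theorem Run.charge_zero (r : Run α) : r.charge 0 = r := by simp [Run.charge]

theorem Reduces.trans {p q r : Prog V α} {c d : ℕ} (h₁ : Reduces G p c q)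
    (h₂ : Reduces G q d r) : Reduces G p (c + d) r := by
  induction h₁ with
  | refl => simpa using h₂
  | work _ ih => rw [add_assoc]; exact .work (ih h₂)
  | totalVolume _ ih => rw [add_assoc]; exact .totalVolume (ih h₂)
  | degree _ ih => rw [add_assoc]; exact .degree (ih h₂)
  | neighbors _ ih => rw [add_assoc]; exact .neighbors (ih h₂)

theorem Reduces.bind {p q : Prog V α} {c : ℕ} (h : Reduces G p c q) (f : α → Prog V β) :
    Reduces G (p >>= f) c (q >>= f) := by
  induction h with
  | refl => exact .refl _
  | work _ ih => exact .work ih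
  | totalVolume _ ih => exact .totalVolume (k := fun m => (_ : ℕ → Prog V α) m >>= f) ih
  | degree _ ih => exact .degree (k := fun m => (_ : ℕ → Prog V α) m >>= f) ih
  | neighbors _ ih => exact .neighbors (k := fun m => (_ : List V → Prog V α) m >>= f) ih

theorem Reduces.outcome {p q : Prog V α} {c : ℕ} (h : Reduces G p c q) {r : Run α}
    (hr : Outcome G p r) : ∃ r', Outcome G q r' ∧ r = r'.charge c := by
  induction h generalizing r with
  | refl p => exact ⟨r, hr, (Run.charge_zero r).symm⟩
  | work _ ih =>
    cases hr with
    | work h => obtain ⟨r', h', rfl⟩ := ih h; exact ⟨r', h', Run.charge_charge _ _ _⟩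
  | totalVolume _ ih =>
    cases hr with
    | totalVolume h => obtain ⟨r', h', rfl⟩ := ih h; exact ⟨r', h', Run.charge_charge _ _ _⟩
  | degree _ ih =>
    cases hr with
    | degree h => obtain ⟨r', h', rfl⟩ := ih h; exact ⟨r', h', Run.charge_charge _ _ _⟩
  | neighbors _ ih =>
    cases hr with
    | neighbors h => obtain ⟨r', h', rfl⟩ := ih h; exact ⟨r', h', Run.charge_charge _ _ _⟩

theorem Computes.mono {p : Prog V α} {a : α} {M N : ℕ} (h : Computes G p a M) (hMN : M ≤ N) :
    Computes G p a N :=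
  let ⟨c, hc, hr⟩ := h
  ⟨c, hc.trans hMN, hr⟩

theorem Computes.bind {p : Prog V α} {f : α → Prog V β} {a : α} {b : β} {M N : ℕ}
    (h₁ : Computes G p a M) (h₂ : Computes G (f a) b N) : Computes G (p >>= f) b (M + N) :=
  let ⟨c, hc, hr⟩ := h₁
  let ⟨d, hd, hs⟩ := h₂
  ⟨c + d, add_le_add hc hd, (hr.bind f).trans hs⟩

variable (G) in
theorem Computes.op (a : α) : Computes G (Prog.op a) a 1 := ⟨1, le_rfl, .work (.refl _)⟩

theorem Computes.degree (v : V) : Computes G (Prog.degree v Prog.op) (G.degree v) 2 :=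
  ⟨1 + (1 + 0), le_rfl, .degree (.work (.refl _))⟩

theorem Computes.neighbors (v : V) :
    Computes G (Prog.neighbors v Prog.op) (G.neighborFinset v).toList (G.degree v + 2) :=
  ⟨1 + G.degree v + (1 + 0), by omega, .neighbors (.work (.refl _))⟩

theorem Computes.op_bind {a : α} {f : α → Prog V β} {b : β} {N : ℕ} (h : Computes G (f a) b N) :
    Computes G (Prog.op a >>= f) b (N + 1) :=
  ((Computes.op G a).bind h).mono (by omega)

theorem Computes.bind_op {p : Prog V α} {a : α} {N : ℕ} (h : Computes G p a N) (g : α → β) :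
    Computes G (p >>= fun a => Prog.op (g a)) (g a) (N + 1) :=
  h.bind (Computes.op G (g a))

theorem Computes.degree_bind {v : V} {f : ℕ → Prog V β} {b : β} {N : ℕ}
    (h : Computes G (f (G.degree v)) b N) :
    Computes G (Prog.degree v Prog.op >>= f) b (N + 2) :=
  ((Computes.degree v).bind h).mono (by omega)

theorem ae_map_charge {μ : Measure (Run α)} {P Q : Run α → Prop} (c : ℕ) (h : ∀ᵐ r ∂μ, P r)
    (hPQ : ∀ r, P r → Q (r.charge c)) : ∀ᵐ r ∂μ.map (Run.charge c), Q r := by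
  rw [ae_map_iff measurable_from_top.aemeasurable MeasurableSpace.measurableSet_top]
  exact h.mono hPQ

variable [DecidableEq V]

/-- Instructions without randomness only shift the clock, so they can be stripped without affecting
the distribution of the result. -/
theorem Reduces.law {p q : Prog V α} {c : ℕ} (h : Reduces G p c q) :
    p.law G = (q.law G).map (Run.charge c) := by
  have key : ∀ (c d : ℕ) (μ : Measure (Run α)),
      (μ.map (Run.charge d)).map (Run.charge c) = μ.map (Run.charge (c + d)) := by
    intro c d μ
    rw [Measure.map_map (measurable_from_top) (measurable_from_top)]
    congr 1
    ext1 r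
    simp [Run.charge, add_assoc]
  induction h with
  | refl p =>
    have : (Run.charge 0 : Run α → Run α) = id := funext Run.charge_zero
    rw [this, Measure.map_id]
  | work _ ih => rw [Prog.law, ih, key]
  | totalVolume _ ih => rw [Prog.law, ih, key]
  | degree _ ih => rw [Prog.law, ih, key]
  | neighbors _ ih => rw [Prog.law, ih, key]

theorem ae_outcome (p : Prog V α) : ∀ᵐ r ∂p.law G, Outcome G p r := by
  induction p with
  | ret a =>
    rw [Prog.law, ae_dirac_iff MeasurableSpace.measurableSet_top]
    exact .ret a
  | work k ih => exact ae_map_charge 1 ih fun r h => .work h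
  | totalVolume k ih => exact ae_map_charge 1 (ih _) fun r h => .totalVolume h
  | degree v k ih => exact ae_map_charge 1 (ih _) fun r h => .degree h
  | neighbors v k ih => exact ae_map_charge _ (ih _) fun r h => .neighbors h
  | randomNeighbor v k ih =>
    refine ae_map_charge (P := fun r => ∃ u ∈ G.neighborFinset v, Outcome G (k u) r) 1 ?_
      fun r ⟨u, hu, h⟩ => .randomNeighbor hu h
    rw [ae_iff, Measure.finsetSum_apply]
    refine Finset.sum_eq_zero fun u hu => ?_
    rw [Measure.smul_apply, smul_eq_mul, mul_eq_zero]
    right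
    exact measure_mono_null (fun r hr h => hr ⟨u, hu, h⟩) (ae_iff.1 (ih u))
  | coin k ih =>
    refine ae_map_charge (P := fun r => ∃ b, Outcome G (k b) r) 1 ?_ fun r ⟨b, h⟩ => .coin b h
    have hb : ∀ b, (k b).law G {r | ¬ ∃ b, Outcome G (k b) r} = 0 := fun b =>
      measure_mono_null (fun r hr h => hr ⟨b, h⟩) (ae_iff.1 (ih b))
    rw [ae_iff, Measure.add_apply, Measure.smul_apply, Measure.smul_apply, hb, hb]
    simp
  | uniform a k ih =>
    refine ae_map_charge (P := fun r => ∃ z ∈ Set.Icc 0 a, Outcome G (k z) r) 1 ?_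
      fun r ⟨z, hz, h⟩ => .uniform hz h
    by_cases hm : AEMeasurable (fun z => (k z).law G)
        (ProbabilityTheory.cond volume (Set.Icc (0 : ℝ) a))
    · rw [ae_iff, Measure.bind_apply MeasurableSpace.measurableSet_top hm]
      refine (lintegral_eq_zero_iff' ((Measure.measurable_coe MeasurableSpace.measurableSet_top).comp_aemeasurable hm)).2 ?_
      filter_upwards [ProbabilityTheory.ae_cond_mem measurableSet_Icc] with z hz
      exact measure_mono_null (fun r hr h => hr ⟨z, hz, h⟩) (ae_iff.1 (ih z))
    -- For a continuation that is not a.e. measurable, `Measure.bind` is the zero measure by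
    -- convention and the claim is vacuous. Hence total mass one is a separate matter.
    · have : Measure.bind (ProbabilityTheory.cond volume (Set.Icc (0 : ℝ) a))
          (fun z => (k z).law G) = 0 := by
        rw [Measure.bind, Measure.map_of_not_aemeasurable hm, Measure.join_zero]
      rw [this]
      simp

end Semantics

/-! ## Dictionaries -/

section Dictionary

open RBNode

variable {V β : Type} [LinearOrder V]

/-- The comparison of dictionary entries by their keys. -/
abbrev keyCmp : V × β → V × β → Ordering := compareOn Prod.fst

/-- A valid red-black tree that stores exactly the values of the partial function `f`. -/
structure Represents (t : Dict V β) (f : V → Option β) : Prop where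
  ordered : t.Ordered keyCmp
  balanced : ∃ c n, t.Balanced c n
  mem_iff : ∀ y b, (y, b) ∈ t ↔ f y = some b

theorem represents_nil : Represents (.nil : Dict V β) fun _ => none where
  ordered := trivial
  balanced := ⟨_, _, .nil⟩
  mem_iff := by simp

theorem Represents.find {t : Dict V β} {f : V → Option β} (h : Represents t f) (y : V) :
    (t.find? fun e => compare y e.1).map Prod.snd = f y := by
  have key : ∀ b, t.find? (fun e => compare y e.1) = some (y, b) ↔ f y = some b := by
    intro b
    rw [← h.mem_iff]
    exact (h.ordered.find?_some (cut := keyCmp (y, b)) (x := (y, b))).trans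
      ⟨fun H => H.1, fun H => ⟨H, by simp [compareOn]⟩⟩
  cases hf : f y with
  | some b => rw [(key b).2 hf]; rfl
  | none =>
    cases ht : t.find? (fun e => compare y e.1) with
    | none => rfl
    | some e =>
      have h1 : compare y e.1 = .eq :=
        RBNode.find?_some_eq_eq (cut := fun e : V × β => compare y e.1) ht
      obtain ⟨y', b⟩ := e
      obtain rfl : y = y' := compare_eq_iff_eq.1 h1
      rw [(key b).1 ht] at hf
      simp at hf

theorem Represents.insert {t : Dict V β} {f : V → Option β} (h : Represents t f) (y : V) (b : β) :
    Represents (t.insert keyCmp (y, b)) (Function.update f y (some b)) where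
  ordered := h.ordered.insert
  balanced := let ⟨_, _, hb⟩ := h.balanced; hb.insert
  mem_iff y' b' := by
    obtain ⟨c, n, hb⟩ := h.balanced
    rw [RBNode.mem_insert hb h.ordered, ne_eq,
      h.ordered.find?_some (cut := keyCmp (y, b)) (x := (y', b')), h.mem_iff]
    by_cases hy : y' = y
    · subst hy
      simp [compareOn, eq_comm]
    · simp [hy, compareOn, Ne.symm hy]

theorem append_toList {α : Type} (s t : RBNode α) :
    (s.append t).toList = s.toList ++ t.toList := by
  fun_induction RBNode.append s t with
  -- Here and in `case5` the inner concatenation has a red root, which is pulled up; the in-order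
  -- list is unaffected.
  | case3 a x b c y d a' z c' h ih => 
    rw [h, toList_node] at ih
    simpa using congrArg (a.toList ++ x :: · ++ y :: d.toList) ih
  | case5 a x b c y d a' z c' h ih => 
    rw [h, toList_node] at ih
    simpa using congrArg (a.toList ++ x :: · ++ y :: d.toList) ih
  | _ => simp_all

theorem or_or_and_iff_of_imp {P Q R T : Prop} (h₁ : R → T) (h₂ : Q → T) :
    (P ∧ T) ∨ R ∨ Q ↔ (P ∨ R ∨ Q) ∧ T := by
  tauto

theorem or_or_and_iff_of_imp' {P Q R T : Prop} (h₁ : R → T) (h₂ : P → T) :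
    P ∨ R ∨ (Q ∧ T) ↔ (P ∨ R ∨ Q) ∧ T := by
  tauto

/-- By the ordering, the part of the tree that the search leaves aside contains no entry with key
`y`. At a match neither child contains one, so concatenating the children drops exactly the matched
entry. -/
theorem mem_del_iff {t : Dict V β} (ht : t.Ordered keyCmp) (y : V) (e : V × β) :
    e ∈ t.del (fun e => compare y e.1) ↔ e ∈ t ∧ e.1 ≠ y := by
  induction t with
  | nil => simp [RBNode.del]
  | node c l a r ihl ihr =>
    obtain ⟨hl, hr, hlo, hro⟩ := ht
    have hl' : ∀ e ∈ l, e.1 < a.1 := fun e he => by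
      simpa [cmpLT_iff, compareOn, compare_lt_iff_lt] using (RBNode.All_def.1 hl) e he
    have hr' : ∀ e ∈ r, a.1 < e.1 := fun e he => by
      simpa [cmpLT_iff, compareOn, compare_lt_iff_lt] using (RBNode.All_def.1 hr) e he
    have hn : e ∈ RBNode.node c l a r ↔ e ∈ l ∨ e = a ∨ e ∈ r := by
      rw [RBNode.mem_node, or_left_comm]
    have hbl : ∀ s : Dict V β, e ∈ s.balLeft a r ↔ e ∈ s ∨ e = a ∨ e ∈ r := by
      intro s; rw [← RBNode.mem_toList]; simp
    have hbr : ∀ s : Dict V β, e ∈ l.balRight a s ↔ e ∈ l ∨ e = a ∨ e ∈ s := by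
      intro s; rw [← RBNode.mem_toList]; simp
    have hnl : ∀ (s : Dict V β) c, e ∈ RBNode.node c s a r ↔ e ∈ s ∨ e = a ∨ e ∈ r := by
      intro s c; rw [RBNode.mem_node, or_left_comm]
    have hnr : ∀ (s : Dict V β) c, e ∈ RBNode.node c l a s ↔ e ∈ l ∨ e = a ∨ e ∈ s := by
      intro s c; rw [RBNode.mem_node, or_left_comm]
    have happ : e ∈ l.append r ↔ e ∈ l ∨ e ∈ r := by
      rw [← RBNode.mem_toList, append_toList]; simp
    rw [hn, RBNode.del]
    have e1 : e ∈ l → e.1 < a.1 := hl' e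
    have e2 : e ∈ r → a.1 < e.1 := hr' e
    have e3 : e = a → e.1 = a.1 := fun h => by rw [h]
    rcases lt_trichotomy y a.1 with h | h | h
    · have h1 : e = a → e.1 ≠ y := fun h' => by rw [h']; exact h.ne'
      have h2 : e ∈ r → e.1 ≠ y := fun h' => (h.trans (e2 h')).ne'
      rw [compare_lt_iff_lt.2 h]
      have := ihl hlo
      cases l.isBlack <;> simp only [hbl, hnl, this] <;> exact or_or_and_iff_of_imp h1 h2
    · have h1 : e ∈ l → e.1 ≠ y := fun h' => (e1 h').ne.trans_eq h.symm
      have h2 : e ∈ r → e.1 ≠ y := fun h' => (e2 h').ne'.trans_eq h.symm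
      have h3 : e = a → e.1 = y := fun h' => (e3 h').trans h.symm
      rw [compare_eq_iff_eq.2 h]
      simp only [happ]
      exact ⟨fun h => h.elim (fun h => ⟨.inl h, h1 h⟩) fun h => ⟨.inr (.inr h), h2 h⟩,
        fun h => h.1.imp_right fun h' => h'.resolve_left fun h'' => h.2 (h3 h'')⟩
    · have h1 : e = a → e.1 ≠ y := fun h' => by rw [h']; exact h.ne
      have h2 : e ∈ l → e.1 ≠ y := fun h' => ((e1 h').trans h).ne
      rw [compare_gt_iff_gt.2 h]
      have := ihr hro
      cases r.isBlack <;> simp only [hbr, hnr, this] <;> exact or_or_and_iff_of_imp' h1 h2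

theorem Represents.erase {t : Dict V β} {f : V → Option β} (h : Represents t f) (y : V) :
    Represents (t.erase fun e => compare y e.1) (Function.update f y none) where
  ordered := h.ordered.erase
  balanced := let ⟨_, _, hb⟩ := h.balanced; let ⟨_, hn⟩ := hb.erase (cut := fun e => compare y e.1); ⟨_, _, hn⟩
  mem_iff y' b' := by
    rw [← RBNode.mem_toList, RBNode.erase, RBNode.setBlack_toList, RBNode.mem_toList,
      mem_del_iff h.ordered, h.mem_iff]
    by_cases hy : y' = y
    · subst hy; simp
    · simp [hy]

theorem Represents.nodup_keys {t : Dict V β} {f : V → Option β} (h : Represents t f) :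
    (t.toList.map Prod.fst).Nodup := by
  have := h.ordered.toList_sorted
  rw [List.Nodup, List.pairwise_map]
  refine this.imp fun {a b} hab => ?_
  rw [cmpLT_iff] at hab
  exact (compare_lt_iff_lt.1 hab).ne

theorem Represents.mem_keys {t : Dict V β} {f : V → Option β} (h : Represents t f) (y : V) :
    y ∈ t.toList.map Prod.fst ↔ (f y).isSome := by
  simp only [List.mem_map, RBNode.mem_toList, Prod.exists, exists_and_right, exists_eq_right,
    h.mem_iff, Option.isSome_iff_exists]

theorem Represents.size_eq [Fintype V] {t : Dict V β} {f : V → Option β} (h : Represents t f) :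
    t.size = (Finset.univ.filter fun y => (f y).isSome).card := by
  rw [RBNode.size_eq, ← List.length_map (f := Prod.fst), ← List.toFinset_card_of_nodup h.nodup_keys]
  congr 1
  ext y
  rw [List.mem_toFinset, h.mem_keys]
  simp

variable (V) in
/-- An upper bound for the depth of a red-black tree whose keys are vertices. -/
def maxDepth [Fintype V] : ℕ := 2 * (Fintype.card V + 1).log2

/-- The keys are distinct vertices, so the tree has at most |V| nodes, and a balanced tree with s
nodes has depth at most 2 log₂(s + 1). -/
theorem Represents.depth_le [Fintype V] {t : Dict V β} {f : V → Option β} (h : Represents t f) :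
    t.depth ≤ maxDepth V := by
  obtain ⟨c, n, hb⟩ := h.balanced
  refine hb.depth_bound.trans ?_
  rw [maxDepth]
  refine Nat.mul_le_mul_left 2 ?_
  rw [Nat.log2_eq_log_two, Nat.log2_eq_log_two]
  refine Nat.log_mono_right ?_
  rw [h.size_eq]
  exact Nat.succ_le_succ (Finset.card_le_univ _)

/-! ### Running times of the dictionary operations -/

section Cost

variable [Fintype V] {G : SimpleGraph V} [DecidableRel G.Adj]

theorem computes_lookup_depth (y : V) (t : Dict V β) :
    Computes G (lookup y t) ((t.find? fun e => compare y e.1).map Prod.snd) (t.depth + 1) := by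
  induction t with
  | nil => exact Computes.op G _
  | node c l e r ihl ihr =>
    rw [lookup, RBNode.find?, RBNode.depth]
    refine (Computes.op_bind (N := max l.depth r.depth + 1) ?_).mono le_rfl
    cases compare y e.1
    · exact ihl.mono (by simp)
    · exact (Computes.op G _).mono (by simp)
    · exact ihr.mono (by simp)

theorem computes_insertRec (y : V) (b : β) (t : Dict V β) :
    Computes G (insertRec y b t) (t.ins keyCmp (y, b)) (2 * t.depth + 1) := by
  induction t with
  | nil => exact Computes.op G _
  | node c l e r ihl ihr =>
    cases c <;> rw [insertRec, RBNode.ins, RBNode.depth] <;>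
    · refine (Computes.op_bind (N := 2 * max l.depth r.depth + 2) ?_).mono (by omega)
      rw [show keyCmp (y, b) e = compare y e.1 from rfl]
      cases compare y e.1
      · exact (ihl.bind_op _).mono (by omega)
      · exact (Computes.op G _).mono (by omega)
      · exact (ihr.bind_op _).mono (by omega)

theorem computes_insert_depth (y : V) (b : β) (t : Dict V β) :
    Computes G (insert y b t) (t.insert keyCmp (y, b)) (2 * t.depth + 3) := by
  rw [insert, RBNode.insert]
  refine (Computes.op_bind (N := 2 * t.depth + 2) ?_).mono le_rfl
  cases t.isRed
  · exact ((computes_insertRec y b t).bind_op _).mono (by omega)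
  · exact (computes_insertRec y b t).mono (by omega)

/-- Every recursive call replaces at least one of the two trees by a child, so the number of calls
is at most the sum of the depths plus one. -/
theorem computes_join (s t : Dict V β) :
    Computes G (join s t) (s.append t) (s.depth + t.depth + 1) := by
  induction s, t using join.induct with
  | case1 t => rw [join, RBNode.append]; exact (Computes.op G _).mono (by omega)
  | case2 s h =>
    cases s
    · exact absurd rfl h
    · rw [join.eq_def, RBNode.append.eq_def]; exact (Computes.op G _).mono (by omega)
  | case3 a x b c y d ih =>
    rw [join, RBNode.append]
    refine (ih.bind (N := 1) ?_).mono (by simp only [RBNode.depth]; omega)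
    cases b.append c with
    | nil => exact Computes.op G _
    | node col _ _ _ => cases col <;> exact Computes.op G _
  | case4 a x b c y d ih =>
    rw [join, RBNode.append]
    refine (ih.bind (N := 1) ?_).mono (by simp only [RBNode.depth]; omega)
    cases b.append c with
    | nil => exact Computes.op G _
    | node col _ _ _ => cases col <;> exact Computes.op G _
  | case5 a x b c y d ih =>
    rw [join, RBNode.append]
    exact (ih.bind_op _).mono (by simp only [RBNode.depth]; omega)
  | case6 a x b c y d ih =>
    rw [join, RBNode.append]
    exact (ih.bind_op _).mono (by simp only [RBNode.depth]; omega)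

theorem computes_eraseRec (y : V) (t : Dict V β) :
    Computes G (eraseRec y t) (t.del fun e => compare y e.1) (2 * t.depth + 1) := by
  induction t with
  | nil => exact Computes.op G _
  | node c l e r ihl ihr =>
    rw [eraseRec, RBNode.del, RBNode.depth]
    refine (Computes.op_bind (N := 2 * max l.depth r.depth + 2) ?_).mono (by omega)
    cases compare y e.1
    · refine (ihl.bind (N := 1) ?_).mono (by omega)
      cases l.isBlack <;> exact Computes.op G _
    · exact (computes_join l r).mono (by omega)
    · refine (ihr.bind (N := 1) ?_).mono (by omega)
      cases r.isBlack <;> exact Computes.op G _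

theorem computes_erase_depth (y : V) (t : Dict V β) :
    Computes G (erase y t) (t.erase fun e => compare y e.1) (2 * t.depth + 2) :=
  (computes_eraseRec y t).bind_op RBNode.setBlack

/-- A tree with s nodes has s + 1 empty leaves, and each node and each leaf costs one step. -/
theorem computes_entriesRec (t : Dict V β) (acc : List (V × β)) :
    Computes G (entriesRec t acc) (t.toList ++ acc) (2 * t.size + 1) := by
  induction t generalizing acc with
  | nil => exact Computes.op G _
  | node c l e r ihl ihr =>
    rw [entriesRec, RBNode.toList_node, RBNode.size]
    have := (ihr acc).bind (f := fun acc₁ => Prog.op (e :: acc₁) >>= entriesRec l) ((Computes.op G (e :: (r.toList ++ acc))).bind (ihl _))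
    rw [List.append_assoc, List.cons_append]
    exact this.mono (by omega)

theorem computes_entries (t : Dict V β) :
    Computes G (entries t) t.toList (2 * t.size + 1) := by
  have := computes_entriesRec (G := G) t []
  rwa [List.append_nil] at this

theorem Represents.computes_lookup {t : Dict V β} {f : V → Option β} (h : Represents t f) (y : V) :
    Computes G (lookup y t) (f y) (maxDepth V + 1) := by
  rw [← h.find y]
  exact (computes_lookup_depth y t).mono (Nat.succ_le_succ h.depth_le)

theorem Represents.computes_insert {t : Dict V β} {f : V → Option β} (h : Represents t f) (y : V)
    (b : β) : ∃ t', Represents t' (Function.update f y (some b)) ∧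
      Computes G (EvoSet.insert y b t) t' (2 * maxDepth V + 3) :=
  ⟨_, h.insert y b, (computes_insert_depth y b t).mono (by have := h.depth_le; omega)⟩

theorem Represents.computes_erase {t : Dict V β} {f : V → Option β} (h : Represents t f) (y : V) :
    ∃ t', Represents t' (Function.update f y none) ∧
      Computes G (EvoSet.erase y t) t' (2 * maxDepth V + 3) :=
  ⟨_, h.erase y, (computes_erase_depth y t).mono (by have := h.depth_le; omega)⟩

end Cost

end Dictionary

end EvoSet

namespace EvoSet

open MeasureTheory RBTree

/-! ## Edge counts -/

section Graph

variable {V : Type} [Fintype V] (G : SimpleGraph V) [DecidableRel G.Adj]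

/-- The number `e(y, S)` of neighbors of `y` in `S`. -/
def edgesInto (y : V) (S : Finset V) : ℕ := (S.filter (G.Adj y)).card

variable {G}

theorem edgesInto_le_degree (y : V) (S : Finset V) : edgesInto G y S ≤ G.degree y := by
  rw [edgesInto, ← SimpleGraph.card_neighborFinset_eq_degree]
  refine Finset.card_le_card fun z hz => ?_
  simpa using (Finset.mem_filter.1 hz).2

variable [DecidableEq V]

theorem edgesInto_add_edgesInto_compl (y : V) (S : Finset V) :
    edgesInto G y S + edgesInto G y Sᶜ = G.degree y := by
  rw [edgesInto, edgesInto, ← Finset.card_union_of_disjoint,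
    ← Finset.filter_union, Finset.union_compl, ← SimpleGraph.card_neighborFinset_eq_degree]
  · congr 1
    ext z
    simp
  · exact (Finset.disjoint_filter_filter disjoint_compl_right)

theorem edgesInto_insert (y : V) {z : V} {S : Finset V} (hz : z ∉ S) :
    edgesInto G y (Insert.insert z S) = edgesInto G y S + if G.Adj y z then 1 else 0 := by
  rw [edgesInto, Finset.filter_insert, edgesInto]
  split_ifs
  · rw [Finset.card_insert_of_notMem (by simp [hz])]
  · rfl

theorem cut_eq_sum (S : Finset V) : cut G S = ∑ y ∈ S, edgesInto G y Sᶜ := by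
  rw [cut, SimpleGraph.interedges_def, Finset.card_filter, Finset.sum_product]
  exact Finset.sum_congr rfl fun y _ => by rw [edgesInto, Finset.card_filter]

theorem cut_eq_sum_compl (S : Finset V) : cut G S = ∑ y ∈ Sᶜ, edgesInto G y S := by
  rw [cut, SimpleGraph.interedges_def, Finset.card_filter, Finset.sum_product_right]
  refine Finset.sum_congr rfl fun y _ => ?_
  rw [edgesInto, Finset.card_filter]
  simp only [G.adj_comm y]

theorem cut_add_sum (S : Finset V) : cut G S + ∑ y ∈ S, edgesInto G y S = vol G S := by
  rw [cut_eq_sum, vol, ← Finset.sum_add_distrib]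
  exact Finset.sum_congr rfl fun y _ => by rw [add_comm, edgesInto_add_edgesInto_compl]

theorem cut_le_vol (S : Finset V) : cut G S ≤ vol G S := by
  rw [← cut_add_sum]
  exact Nat.le_add_right _ _

/-- Compare the degree sums over the two sets: the edges from `y` into `S` become inner edges and
are then counted from both ends. The additive form avoids truncated subtraction. -/
theorem cut_insert {y : V} {S : Finset V} (hy : y ∉ S) :
    cut G (Insert.insert y S) + 2 * edgesInto G y S = cut G S + G.degree y := by
  have h₁ := cut_add_sum (G := G) S
  have h₂ := cut_add_sum (G := G) (Insert.insert y S)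
  have h₃ : vol G (Insert.insert y S) = G.degree y + vol G S := Finset.sum_insert hy
  rw [Finset.sum_insert hy, edgesInto_insert y hy, if_neg (G.irrefl),
    Finset.sum_congr rfl fun z _ => edgesInto_insert z hy, Finset.sum_add_distrib] at h₂
  have h₄ : ∑ z ∈ S, (if G.Adj z y then 1 else 0) = edgesInto G y S := by
    rw [edgesInto, Finset.card_filter]
    simp only [G.adj_comm y]
  omega

theorem symmDiff_singleton_of_mem {y : V} {S : Finset V} (hy : y ∈ S) :
    symmDiff S {y} = S.erase y := by
  ext z
  by_cases hz : z = y <;> simp [Finset.mem_symmDiff, hz, hy]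

theorem symmDiff_singleton_of_notMem {y : V} {S : Finset V} (hy : y ∉ S) :
    symmDiff S {y} = Insert.insert y S := by
  ext z
  by_cases hz : z = y <;> simp [Finset.mem_symmDiff, hz, hy]

/-- The truncated subtraction is harmless: it occurs only when `y ∈ S` is itself a neighbor of `z`.
-/
theorem edgesInto_symmDiff_singleton (z y : V) (S : Finset V) :
    edgesInto G z (symmDiff S {y}) =
      if G.Adj y z then (if y ∈ S then edgesInto G z S - 1 else edgesInto G z S + 1)
      else edgesInto G z S := by
  by_cases hy : y ∈ S
  · rw [symmDiff_singleton_of_mem hy]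
    have := edgesInto_insert (G := G) z (Finset.notMem_erase y S)
    rw [Finset.insert_erase hy] at this
    rw [this]
    simp only [G.adj_comm z y]
    split_ifs <;> simp
  · rw [symmDiff_singleton_of_notMem hy, edgesInto_insert z hy]
    simp only [G.adj_comm z y]
    split_ifs <;> simp

theorem cut_symmDiff_singleton (y : V) (S : Finset V) :
    cut G (symmDiff S {y}) =
      if y ∈ S then cut G S + 2 * edgesInto G y S - G.degree y
      else cut G S + G.degree y - 2 * edgesInto G y S := by
  have h := edgesInto_symmDiff_singleton (G := G) y y S
  rw [if_neg G.irrefl] at h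
  split_ifs with hy
  · have h' := cut_insert (G := G) (Finset.notMem_erase y S)
    rw [symmDiff_singleton_of_mem hy] at h ⊢
    rw [Finset.insert_erase hy] at h'
    omega
  · have h' := cut_insert (G := G) hy
    rw [symmDiff_singleton_of_notMem hy]
    omega

/-! ### Transition probabilities and the vertex boundary -/

theorem walkInto_eq (y : V) (S : Finset V) :
    walkInto G y S =
      ((edgesInto G y S : ℝ) / (G.degree y : ℝ) + if y ∈ S then 1 else 0) / 2 := by
  have h : ∀ z, walk G y z =
      (if G.Adj y z then 1 / (2 * (G.degree y : ℝ)) else 0) + if y = z then 1 / 2 else 0 := by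
    intro z
    rw [walk]
    split_ifs with h₁ h₂ <;> simp_all
  rw [walkInto, Finset.sum_congr rfl fun z _ => h z, Finset.sum_add_distrib, Finset.sum_ite_eq,
    ← Finset.sum_filter, Finset.sum_const, nsmul_eq_mul, edgesInto]
  split_ifs <;> ring

theorem walkInto_nonneg (y : V) (S : Finset V) : 0 ≤ walkInto G y S := by
  rw [walkInto_eq]
  split_ifs <;> positivity

theorem walkInto_le_one (y : V) (S : Finset V) : walkInto G y S ≤ 1 := by
  rw [walkInto_eq]
  have : (edgesInto G y S : ℝ) / (G.degree y : ℝ) ≤ 1 :=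
    div_le_one_of_le₀ (by exact_mod_cast edgesInto_le_degree y S) (by positivity)
  split_ifs <;> linarith

variable (G) in
/-- The entry of `z` in the boundary dictionary of `S` if `e(z, S) = k`. -/
def boundaryEntry (S : Finset V) (k : ℕ) (z : V) : Option ℕ :=
  if (if z ∈ S then k < G.degree z else 0 < k) then some k else none

variable (G) in
/-- The two-sided vertex boundary `δ(S)`. -/
def vertexBoundary (S : Finset V) : Finset V :=
  {z | if z ∈ S then edgesInto G z S < G.degree z else 0 < edgesInto G z S}

theorem isSome_boundaryEntry (S : Finset V) (z : V) :
    (boundaryEntry G S (edgesInto G z S) z).isSome ↔ z ∈ vertexBoundary G S := by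
  rw [boundaryEntry, vertexBoundary, Finset.mem_filter]
  split_ifs <;> simp_all

/-- A boundary vertex on either side has an edge to the other side, so each of the two halves of the
boundary has at most ∂(S) vertices. -/
theorem card_vertexBoundary_le (S : Finset V) : (vertexBoundary G S).card ≤ 2 * cut G S := by
  rw [two_mul]
  nth_rewrite 1 [cut_eq_sum]
  rw [cut_eq_sum_compl, vertexBoundary, Finset.card_filter, ← Finset.sum_add_sum_compl S]
  refine add_le_add (Finset.sum_le_sum fun z hz => ?_) (Finset.sum_le_sum fun z hz => ?_)
  · have := edgesInto_add_edgesInto_compl (G := G) z S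
    simp only [hz, if_true]
    split_ifs <;> omega
  · simp only [Finset.mem_compl.1 hz, if_false]
    split_ifs <;> omega

/-- Together with `walkInto_eq_zero` this is the reason why scanning the boundary suffices: no
threshold in (0, 1] moves a vertex off the boundary. -/
theorem walkInto_eq_one {y : V} {S : Finset V} (hd : 0 < G.degree y) (hy : y ∈ S)
    (hb : y ∉ vertexBoundary G S) : walkInto G y S = 1 := by
  rw [vertexBoundary, Finset.mem_filter, if_pos hy] at hb
  have h : edgesInto G y S = G.degree y :=
    le_antisymm (edgesInto_le_degree y S) (not_lt.1 fun h => hb ⟨Finset.mem_univ _, h⟩)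
  have : (G.degree y : ℝ) ≠ 0 := by exact_mod_cast hd.ne'
  rw [walkInto_eq, if_pos hy, h, div_self this]
  norm_num

theorem walkInto_eq_zero {y : V} {S : Finset V} (hy : y ∉ S)
    (hb : y ∉ vertexBoundary G S) : walkInto G y S = 0 := by
  rw [vertexBoundary, Finset.mem_filter, if_neg hy] at hb
  have h : edgesInto G y S = 0 := by
    by_contra h
    exact hb ⟨Finset.mem_univ _, Nat.pos_of_ne_zero h⟩
  rw [walkInto_eq, if_neg hy, h]
  norm_num

theorem vol_le_vol_add_vol_symmDiff (S T : Finset V) :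
    vol G T ≤ vol G S + vol G (symmDiff T S) := by
  rw [vol, vol, vol, ← Finset.sum_union_inter]
  refine (Finset.sum_le_sum_of_subset fun z hz => ?_).trans (Nat.le_add_right _ _)
  by_cases h : z ∈ S <;> simp [Finset.mem_symmDiff, h, hz]

theorem card_le_vol (hG : ∀ v, 0 < G.degree v) (S : Finset V) : S.card ≤ vol G S := by
  rw [Finset.card_eq_sum_ones, vol]
  exact Finset.sum_le_sum fun v _ => hG v

theorem vol_symmDiff_singleton (y : V) (S : Finset V) :
    vol G (symmDiff S {y}) = if y ∈ S then vol G S - G.degree y else vol G S + G.degree y := by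
  split_ifs with hy
  · rw [symmDiff_singleton_of_mem hy, vol, vol, ← Finset.sum_erase_add _ _ hy,
      Nat.add_sub_cancel]
  · rw [symmDiff_singleton_of_notMem hy, vol, vol, Finset.sum_insert hy, add_comm]

end Graph

/-! ## The set-with-boundary data structure -/

section Structure

variable {V : Type} [Fintype V] [LinearOrder V] (G : SimpleGraph V) [DecidableRel G.Adj]

/-- The dictionary `M` stores the set `S`. -/
def StoresSet (M : Dict V Unit) (S : Finset V) : Prop :=
  Represents M fun z => if z ∈ S then some () else none

/-- The data structure stores the set `S` and the edge counts `e`. -/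
structure Stores (D : BoundarySet V) (S : Finset V) (e : V → ℕ) : Prop where
  members : StoresSet D.members S
  boundary : Represents D.boundary fun z => boundaryEntry G S (e z) z
  le_degree : ∀ z, e z ≤ G.degree z

/-- The data structure stores the set `S` with its boundary. -/
structure StoresBoundary (D : BoundarySet V) (S : Finset V) : Prop where
  stores : Stores G D S fun z => edgesInto G z S
  cutSize : D.cutSize = cut G S

variable {G}

theorem StoresSet.computes_mem {M : Dict V Unit} {S : Finset V} (h : StoresSet M S)
    {D : BoundarySet V} (hD : D.members = M) (y : V) :
    Computes G (D.mem y) (decide (y ∈ S)) (maxDepth V + 2) := by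
  subst hD
  have hs : decide (y ∈ S) = (if y ∈ S then some () else none).isSome := by
    by_cases hy : y ∈ S <;> simp [hy]
  rw [hs]
  exact (h.computes_lookup y).bind_op Option.isSome

theorem StoresSet.insert {M : Dict V Unit} {S : Finset V} (h : StoresSet M S) {y : V}
    (hy : y ∉ S) : ∃ M', StoresSet M' (symmDiff S {y}) ∧
      Computes G (EvoSet.insert y () M) M' (2 * maxDepth V + 3) := by
  obtain ⟨M', h', hc⟩ := h.computes_insert (G := G) y ()
  refine ⟨M', ?_, hc⟩
  rw [StoresSet, symmDiff_singleton_of_notMem hy]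
  convert h' using 1
  ext1 z
  by_cases hz : z = y
  · subst hz; simp
  · simp [hz]

theorem StoresSet.erase {M : Dict V Unit} {S : Finset V} (h : StoresSet M S) {y : V}
    (hy : y ∈ S) : ∃ M', StoresSet M' (symmDiff S {y}) ∧
      Computes G (EvoSet.erase y M) M' (2 * maxDepth V + 3) := by
  obtain ⟨M', h', hc⟩ := h.computes_erase (G := G) y
  refine ⟨M', ?_, hc⟩
  rw [StoresSet, symmDiff_singleton_of_mem hy]
  convert h' using 1
  ext1 z
  by_cases hz : z = y
  · subst hz; simp
  · simp [hz]

/-- A missing entry means a count of at least the degree inside the set and of zero outside. As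
counts never exceed degrees, membership then determines the count. -/
theorem Stores.computes_edges {D : BoundarySet V} {S : Finset V} {e : V → ℕ}
    (h : Stores G D S e) (y : V) : Computes G (D.edges y) (e y) (2 * maxDepth V + 5) := by
  rw [BoundarySet.edges]
  refine ((h.boundary.computes_lookup y).bind (N := maxDepth V + 4) ?_).mono (by omega)
  have hle := h.le_degree y
  rw [boundaryEntry]
  by_cases hb : if y ∈ S then e y < G.degree y else 0 < e y
  · rw [if_pos hb]
    exact (Computes.op G _).mono (by omega)
  · rw [if_neg hb]
    refine ((h.members.computes_mem rfl y).bind (N := 2) ?_).mono (by omega)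
    by_cases hy : y ∈ S
    · rw [if_pos hy] at hb
      rw [if_pos (by simpa using hy), show e y = G.degree y by omega]
      exact Computes.degree y
    · rw [if_neg hy] at hb
      rw [if_neg (by simpa using hy), show e y = 0 by omega]
      exact (Computes.op G _).mono (by omega)

theorem StoresBoundary.computes_prob {D : BoundarySet V} {S : Finset V}
    (h : StoresBoundary G D S) (y : V) :
    Computes G (D.prob y) (walkInto G y S) (3 * maxDepth V + 10) := by
  rw [BoundarySet.prob]
  refine ((h.stores.computes_edges y).bind ((h.stores.members.computes_mem rfl y).bind
    (Computes.degree_bind (N := 1) ?_))).mono (by omega)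
  rw [walkInto_eq]
  convert Computes.op G _ using 4
  simp

/-- The old content `f` is arbitrary because in the middle of a toggle the membership dictionary
already holds the new set while the boundary dictionary still belongs to the old one. -/
theorem computes_record {D : BoundarySet V} {S : Finset V} {f : V → Option ℕ}
    (hM : StoresSet D.members S) (hb : Represents D.boundary f) (z : V) (k : ℕ) :
    ∃ D' : BoundarySet V, D'.members = D.members ∧ D'.cutSize = D.cutSize ∧
      Represents D'.boundary (Function.update f z (boundaryEntry G S k z)) ∧
      Computes G (D.record z k) D' (3 * maxDepth V + 9) := by
  have key : ∃ b', Represents b' (Function.update f z (boundaryEntry G S k z)) ∧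
      Computes G (if (if decide (z ∈ S) = true then decide (k < G.degree z)
          else decide (0 < k)) = true then do
        let b ← insert z k D.boundary
        Prog.op (⟨D.members, b, D.cutSize⟩ : BoundarySet V)
      else do
        let b ← erase z D.boundary
        Prog.op (⟨D.members, b, D.cutSize⟩ : BoundarySet V)) ⟨D.members, b', D.cutSize⟩
          (2 * maxDepth V + 4) := by
    rw [boundaryEntry]
    by_cases h : if z ∈ S then k < G.degree z else 0 < k
    · obtain ⟨b', h', hc⟩ := hb.computes_insert (G := G) z k
      refine ⟨b', by rwa [if_pos h], ?_⟩
      rw [if_pos (by split_ifs at h ⊢ <;> simp_all)]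
      exact hc.bind_op fun b => (⟨D.members, b, D.cutSize⟩ : BoundarySet V)
    · obtain ⟨b', h', hc⟩ := hb.computes_erase (G := G) z
      refine ⟨b', by rwa [if_neg h], ?_⟩
      rw [if_neg (by split_ifs at h ⊢ <;> simp_all)]
      exact hc.bind_op fun b => (⟨D.members, b, D.cutSize⟩ : BoundarySet V)
  obtain ⟨b', h', hc⟩ := key
  refine ⟨⟨D.members, b', D.cutSize⟩, rfl, rfl, h', ?_⟩
  exact ((hM.computes_mem rfl z).bind (Computes.degree_bind (Computes.op_bind hc))).mono
    (by omega)

/-- Without repetitions in the list each count changes only once, so every intermediate count is an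
initial or a final one and stays below the degree. -/
theorem Stores.computes_shift (up : Bool) (l : List V) (hl : l.Nodup) {D : BoundarySet V}
    {S : Finset V} {e e' : V → ℕ} (h : Stores G D S e)
    (he' : ∀ z, e' z = if z ∈ l then (if up then e z + 1 else e z - 1) else e z)
    (hle : ∀ z, e' z ≤ G.degree z) :
    ∃ D', Stores G D' S e' ∧ D'.cutSize = D.cutSize ∧
      Computes G (BoundarySet.shift up l D) D' ((5 * maxDepth V + 15) * l.length + 1) := by
  induction l generalizing D e with
  | nil =>
    obtain rfl : e' = e := funext fun z => by simpa using he' z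
    exact ⟨D, h, rfl, Computes.op G _⟩
  | cons z zs ih =>
    have hz : e' z = if up then e z + 1 else e z - 1 := by simpa using he' z
    obtain ⟨D₁, hM, hc, hb, hr⟩ := computes_record (G := G) h.members h.boundary z (e' z)
    have hs : Stores G D₁ S (Function.update e z (e' z)) := by
      refine ⟨hM ▸ h.members, ?_, fun w => ?_⟩
      · convert hb using 1
        ext1 w
        by_cases hw : w = z
        · subst hw; simp
        · simp [hw]
      · by_cases hw : w = z
        · subst hw; simpa using hle w
        · simpa [hw] using h.le_degree w
    obtain ⟨D', hs', hc', hr'⟩ := ih (List.nodup_cons.1 hl).2 hs fun w => by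
      by_cases hw : w = z
      · subst hw; simp [(List.nodup_cons.1 hl).1]
      · simp [hw, he' w]
    refine ⟨D', hs', hc'.trans hc, ?_⟩
    rw [BoundarySet.shift]
    refine ((h.computes_edges z).bind (Computes.op_bind (Computes.bind ?_ hr'))).mono
      (M := 2 * maxDepth V + 5 + (3 * maxDepth V + 9 +
        ((5 * maxDepth V + 15) * zs.length + 1) + 1)) ?_
    · rw [← hz]; exact hr
    · rw [List.length_cons]; ring_nf; omega

theorem StoresBoundary.computes_toggle {D : BoundarySet V} {S : Finset V}
    (h : StoresBoundary G D S) (y : V) :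
    ∃ D', StoresBoundary G D' (symmDiff S {y}) ∧
      Computes G (D.toggle y) D'
        (8 * maxDepth V + 26 + (5 * maxDepth V + 16) * G.degree y) := by
  have hmem : y ∈ symmDiff S {y} ↔ y ∉ S := by simp [Finset.mem_symmDiff]
  obtain ⟨M, hM, hMc⟩ : ∃ M, StoresSet M (symmDiff S {y}) ∧
      Computes G (if y ∈ S then erase y D.members else insert y () D.members) M
        (2 * maxDepth V + 3) := by
    split_ifs with hy
    · exact h.stores.members.erase hy
    · exact h.stores.members.insert hy
  set c := cut G (symmDiff S {y})
  obtain ⟨D₁, hM₁, hc₁, hb₁, hr₁⟩ := computes_record (G := G) (D := ⟨M, D.boundary, c⟩)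
    hM h.stores.boundary y (edgesInto G y S)
  -- An intermediate state: the new set with the old edge counts. Membership changes only at `y`, so
  -- only the entry of `y` had to be rewritten; `shift` then corrects the counts of the neighbors.
  have hs₁ : Stores G D₁ (symmDiff S {y}) fun z => edgesInto G z S := by
    refine ⟨hM₁ ▸ hM, ?_, fun z => edgesInto_le_degree z S⟩
    convert hb₁ using 1
    ext1 z
    by_cases hz : z = y
    · subst hz; simp
    · simp [hz, boundaryEntry, Finset.mem_symmDiff]
  obtain ⟨D₂, hs₂, hc₂, hr₂⟩ := hs₁.computes_shift (!decide (y ∈ S))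
    (G.neighborFinset y).toList (Finset.nodup_toList _)
    (e' := fun z => edgesInto G z (symmDiff S {y}))
    (fun z => by
      rw [edgesInto_symmDiff_singleton]
      by_cases hy : y ∈ S <;> simp [hy])
    fun z => edgesInto_le_degree z _
  refine ⟨D₂, ⟨hs₂, hc₂.trans hc₁⟩, ?_⟩
  rw [Finset.length_toList, SimpleGraph.card_neighborFinset_eq_degree] at hr₂
  have hrest : Computes G (do
      let S₁ ← Prog.op (⟨M, D.boundary, c⟩ : BoundarySet V)
      let S₂ ← S₁.record y (edgesInto G y S)
      let N ← Prog.neighbors y Prog.op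
      BoundarySet.shift (!decide (y ∈ S)) N S₂) D₂ _ :=
    Computes.op_bind (hr₁.bind ((Computes.neighbors y).bind hr₂))
  rw [BoundarySet.toggle]
  refine ((h.stores.members.computes_mem rfl y).bind ((h.stores.computes_edges y).bind
    (Computes.degree_bind (Computes.op_bind (N := 2 * maxDepth V + 3 + (3 * maxDepth V + 9 +
      (G.degree y + 2 + ((5 * maxDepth V + 15) * G.degree y + 1)) + 1)) ?_)))).mono
      (by ring_nf; omega)
  have hc : (if decide (y ∈ S) = true then D.cutSize + 2 * edgesInto G y S - G.degree y
      else D.cutSize + G.degree y - 2 * edgesInto G y S) = c := by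
    rw [h.cutSize]
    simp only [decide_eq_true_eq]
    exact (cut_symmDiff_singleton y S).symm
  rw [hc]
  by_cases hy : y ∈ S
  · rw [if_pos hy] at hMc
    rw [if_pos (by simpa using hy)]
    exact hMc.bind hrest
  · rw [if_neg hy] at hMc
    rw [if_neg (by simpa using hy)]
    exact hMc.bind hrest

theorem storesBoundary_empty : StoresBoundary G (⟨.nil, .nil, 0⟩ : BoundarySet V) ∅ := by
  refine ⟨⟨?_, ?_, fun z => edgesInto_le_degree z _⟩, ?_⟩
  · rw [StoresSet]
    convert represents_nil (V := V) (β := Unit) using 1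
    simp
  · convert represents_nil (V := V) (β := ℕ) using 1
    simp [boundaryEntry, edgesInto]
  · simp [cut_eq_sum]

theorem StoresBoundary.computes_toggleAll (hG : ∀ v, 0 < G.degree v) (l : List V) (hl : l.Nodup)
    {D : BoundarySet V} {S : Finset V} (h : StoresBoundary G D S) :
    ∃ D', StoresBoundary G D' (symmDiff S l.toFinset) ∧
      Computes G (BoundarySet.toggleAll l D) D'
        ((13 * maxDepth V + 42) * vol G l.toFinset + 1) := by
  induction l generalizing D S with
  | nil => exact ⟨D, by rwa [List.toFinset_nil, ← Finset.bot_eq_empty, symmDiff_bot], (Computes.op G _).mono (by omega)⟩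
  | cons y l ih =>
    obtain ⟨D₁, h₁, hc₁⟩ := h.computes_toggle y
    obtain ⟨D', h', hc'⟩ := ih (List.nodup_cons.1 hl).2 h₁
    refine ⟨D', ?_, (hc₁.bind hc').mono ?_⟩
    · convert h' using 1
      rw [symmDiff_assoc, symmDiff_comm {y} l.toFinset, symmDiff_singleton_of_notMem
        (by simpa using (List.nodup_cons.1 hl).1), List.toFinset_cons]
    · rw [List.toFinset_cons, vol, vol, Finset.sum_insert
        (by simpa using (List.nodup_cons.1 hl).1)]
      -- Since d(y) ≥ 1, the time 8H + 26 + (5H + 16) d(y) of one toggle is at most (13H + 42) d(y),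
      -- where H is `maxDepth V`.
      have := hG y
      generalize ∑ y ∈ l.toFinset, G.degree y = s
      nlinarith

/-- No neighbors are visited, so the time depends on the number of toggled vertices and not on their
volume. This keeps a step that exceeds the budget affordable. -/
theorem StoresSet.computes_toggleMembers (l : List V) (hl : l.Nodup) {M : Dict V Unit}
    {S : Finset V} (h : StoresSet M S) :
    ∃ M', StoresSet M' (symmDiff S l.toFinset) ∧
      Computes G (toggleMembers l M) M' ((3 * maxDepth V + 4) * l.length + 1) := by
  induction l generalizing M S with
  | nil => exact ⟨M, by rwa [List.toFinset_nil, ← Finset.bot_eq_empty, symmDiff_bot], Computes.op G _⟩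
  | cons y l ih =>
    have key : ∃ M₁, StoresSet M₁ (symmDiff S {y}) ∧ ∀ M' N,
        Computes G (toggleMembers l M₁) M' N →
        Computes G (toggleMembers (y :: l) M) M' (3 * maxDepth V + 4 + N) := by
      have hlook := h.computes_lookup (G := G) y
      by_cases hy : y ∈ S
      · obtain ⟨M₁, h₁, hc₁⟩ := h.erase (G := G) hy
        refine ⟨M₁, h₁, fun M' N hN => ?_⟩
        rw [if_pos hy] at hlook
        rw [toggleMembers]
        exact (hlook.bind (hc₁.bind hN)).mono (by omega)
      · obtain ⟨M₁, h₁, hc₁⟩ := h.insert (G := G) hy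
        refine ⟨M₁, h₁, fun M' N hN => ?_⟩
        rw [if_neg hy] at hlook
        rw [toggleMembers]
        exact (hlook.bind (hc₁.bind hN)).mono (by omega)
    obtain ⟨M₁, h₁, hM₁⟩ := key
    obtain ⟨M', h', hc'⟩ := ih (List.nodup_cons.1 hl).2 h₁
    refine ⟨M', ?_, (hM₁ _ _ hc').mono ?_⟩
    · convert h' using 1
      rw [symmDiff_assoc, symmDiff_comm {y} l.toFinset, symmDiff_singleton_of_notMem
        (by simpa using (List.nodup_cons.1 hl).1), List.toFinset_cons]
    · rw [List.length_cons]; ring_nf; omega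

theorem computes_keys (l : List (V × Unit)) :
    Computes G (keys l) (l.map Prod.fst) (l.length + 1) := by
  induction l with
  | nil => exact Computes.op G _
  | cons e l ih =>
    rw [keys]
    exact ih.bind_op _

theorem StoresSet.computes_finish {M : Dict V Unit} {S : Finset V} (h : StoresSet M S)
    (path : List (Finset V)) :
    ∃ l : List V, l.Nodup ∧ l.toFinset = S ∧
      Computes G (finish path M) ⟨path, l⟩ (3 * S.card + 3) := by
  have hS : (M.toList.map Prod.fst).toFinset = S := by
    ext y
    rw [List.mem_toFinset, h.mem_keys]
    split_ifs with hy <;> simp [hy]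
  have hlen : M.toList.length = S.card := by
    rw [← hS, List.toFinset_card_of_nodup h.nodup_keys, List.length_map]
  refine ⟨M.toList.map Prod.fst, h.nodup_keys, hS, ?_⟩
  have h₁ := computes_entries (G := G) M
  rw [RBNode.size_eq, hlen] at h₁
  have h₂ := (computes_keys (G := G) M.toList).bind_op (fun l => (⟨path, l⟩ : Sample V))
  rw [hlen] at h₂
  exact (h₁.bind h₂).mono (by omega)

end Structure

end EvoSet

namespace EvoSet

open MeasureTheory RBTree

/-! ## One step of the algorithm -/

section Step

variable {V : Type} [Fintype V] [LinearOrder V] {G : SimpleGraph V} [DecidableRel G.Adj]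

theorem Reduces.op_bind {α β : Type} (a : α) (f : α → Prog V β) :
    Reduces G (Prog.op a >>= f) 1 (f a) :=
  .work (.refl _)

theorem Reduces.degree_bind {β : Type} (v : V) (f : ℕ → Prog V β) :
    Reduces G (Prog.degree v Prog.op >>= f) 2 (f (G.degree v)) :=
  Reduces.degree (c := 1 + 0) (k := fun d => .work (f d)) (.work (.refl _))

theorem Reduces.totalVolume_bind {β : Type} (f : ℕ → Prog V β) :
    Reduces G (Prog.totalVolume Prog.op >>= f) 2 (f (vol G Finset.univ)) :=
  Reduces.totalVolume (c := 1 + 0) (k := fun m => .work (f m)) (.work (.refl _))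

/-- The list found by `select` and its cost depend on the threshold only through the new set. -/
theorem StoresBoundary.exists_reduces_select {D : BoundarySet V} {S : Finset V}
    (h : StoresBoundary G D S) (N : Finset V) (l : List (V × ℕ)) (hl : (l.map Prod.fst).Nodup)
    (L : List V) (hL : L.Nodup) (hlL : ∀ y ∈ L, y ∉ l.map Prod.fst) (c : ℕ) :
    ∃ (L' : List V) (t : ℕ), L'.Nodup ∧
      (∀ y, y ∈ L' ↔ y ∈ L ∨ y ∈ l.map Prod.fst ∧ ¬ (y ∈ N ↔ y ∈ S)) ∧
      t ≤ (4 * maxDepth V + 18) * l.length + 1 ∧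
      ∀ Z : ℝ, (∀ y, Z ≤ walkInto G y S ↔ y ∈ N) →
        Reduces G (select D Z l L (vol G (symmDiff S L.toFinset)) (c + vol G L.toFinset)) t
          (.ret (L', vol G (symmDiff S L'.toFinset), c + vol G L'.toFinset)) := by
  induction l generalizing L with
  | nil =>
    exact ⟨L, 1, hL, by simp, by simp, fun Z _ => .work (.refl _)⟩
  | cons a l ih =>
    obtain ⟨y, k⟩ := a
    obtain ⟨t₁, ht₁, hp⟩ := h.computes_prob y
    obtain ⟨t₂, ht₂, hm⟩ := h.stores.members.computes_mem (G := G) (D := D) rfl y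
    rw [List.map_cons, List.nodup_cons] at hl
    have hyL : y ∉ L := fun hy => hlL y hy (by simp)
    have hbase : ∀ Z : ℝ, (∀ y, Z ≤ walkInto G y S ↔ y ∈ N) → ∀ m c',
        Reduces G (select D Z ((y, k) :: l) L m c') (t₁ + (t₂ + 1))
          (if decide (y ∈ N) = decide (y ∈ S) then select D Z l L m c'
          else do
            let d ← Prog.degree y Prog.op
            let m' ← Prog.op (if decide (y ∈ S) then m - d else m + d)
            let c' ← Prog.op (c' + d)
            let D' ← Prog.op (y :: L)
            select D Z l D' m' c') := by
      intro Z hZ m c'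
      rw [select]
      refine (hp.bind _).trans ((hm.bind _).trans ?_)
      have : decide (Z ≤ walkInto G y S) = decide (y ∈ N) := by simp only [hZ y]
      rw [← this]
      exact Reduces.op_bind _ _
    by_cases hN : y ∈ N ↔ y ∈ S
    · obtain ⟨L', t, hL', hmem, ht, hr⟩ := ih hl.2 L hL
        fun z hz hz' => hlL z hz (List.mem_cons_of_mem _ hz')
      refine ⟨L', t₁ + (t₂ + 1) + t, hL', fun z => ?_, ?_, fun Z hZ => ?_⟩
      · rw [hmem, List.map_cons, List.mem_cons]
        by_cases hz : z = y
        · subst hz; simp [hN]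
        · simp [hz]
      · rw [List.length_cons]; ring_nf at ht ⊢; omega
      · refine (hbase Z hZ _ _).trans ?_
        rw [if_pos (by simp [hN])]
        exact hr Z hZ
    · obtain ⟨L', t, hL', hmem, ht, hr⟩ := ih hl.2 (y :: L) (List.nodup_cons.2 ⟨hyL, hL⟩)
        fun z hz hz' => by
          rcases List.mem_cons.1 hz with rfl | hz
          · exact hl.1 hz'
          · exact hlL z hz (List.mem_cons_of_mem _ hz')
      refine ⟨L', t₁ + (t₂ + 1) + (2 + (1 + (1 + (1 + t)))), hL', fun z => ?_, ?_, fun Z hZ => ?_⟩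
      · rw [hmem, List.map_cons, List.mem_cons, List.mem_cons]
        by_cases hz : z = y
        · subst hz; simp [hN]
        · simp [hz]
      · rw [List.length_cons]; ring_nf at ht ⊢; omega
      · refine (hbase Z hZ _ _).trans ?_
        rw [if_neg (by simpa using hN)]
        refine (Reduces.degree_bind _ _).trans ((Reduces.op_bind _ _).trans
          ((Reduces.op_bind _ _).trans ((Reduces.op_bind _ _).trans ?_)))
        -- Adding `y` to the list changes the volume of the new set by ±d(y), according to its
        -- membership in `S`, and the cost by d(y).
        convert hr Z hZ using 2
        · have hy' : y ∉ L.toFinset := by simpa using hyL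
          have : (y :: L).toFinset = symmDiff L.toFinset {y} := by
            rw [symmDiff_singleton_of_notMem hy', List.toFinset_cons]
          rw [this, ← symmDiff_assoc, vol_symmDiff_singleton]
          simp [Finset.mem_symmDiff, hyL]
        · rw [List.toFinset_cons, vol, vol, Finset.sum_insert (by simpa using hyL)]
          omega

variable (G) in
/-- The successor of `S` computed by the algorithm if the vertices with `p(y, S)` at least the
threshold are those in `N`. -/
def nextSet (S N : Finset V) : Finset V :=
  symmDiff S ((vertexBoundary G S).filter fun y => ¬ (y ∈ N ↔ y ∈ S))

variable (G) in
theorem symmDiff_nextSet (S N : Finset V) :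
    symmDiff (nextSet G S N) S = (vertexBoundary G S).filter fun y => ¬ (y ∈ N ↔ y ∈ S) := by
  rw [nextSet, symmDiff_comm, symmDiff_symmDiff_cancel_left]

variable (G) in
/-- The algorithm halts at `S`, where `left` is the number of steps left until time `T` and `c` is
the cost of the path. -/
def Halts (θ : ℝ) (B left : ℕ) (S : Finset V) (c : ℕ) : Prop :=
  (left = 0 ∨ B < c) ∨ conductance G S < θ

/-- The remainder of a step of `steps` after the threshold is drawn. -/
noncomputable def afterDraw (θ : ℝ) (B left : ℕ) (D : BoundarySet V) (X : V) (m c : ℕ)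
    (S : Finset V) (path : List (Finset V)) (Z : ℝ) : Prog V (Sample V) := do
  let δ ← entries D.boundary
  let c₀ ← Prog.op (c + D.cutSize)
  let (L, m', c') ← select D Z δ [] m c₀
  let S' := symmDiff S L.toFinset
  let path' := path ++ [S']
  let halt ← Prog.op (decide (left = 0) || decide (B < c'))
  if halt then do
    let M ← toggleMembers L D.members
    finish path' M
  else do
    let D' ← BoundarySet.toggleAll L D
    let small ← Prog.op (decide ((D'.cutSize : ℝ) / (m' : ℝ) < θ))
    if small then finish path' D'.members
    else steps θ B left D' X m' c' S' path'

theorem steps_succ (θ : ℝ) (B left : ℕ) (D : BoundarySet V) (X : V) (m c : ℕ)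
    (S : Finset V) (path : List (Finset V)) :
    steps θ B (left + 1) D X m c S path =
      walkStep X >>= fun X' => D.prob X' >>= fun q => Prog.uniform q Prog.op >>= fun Z =>
        afterDraw θ B left D X' m c S path Z :=
  rfl

-- The data `D'`, `out` and `t` depend on the threshold only through `N` and not at all on the
-- particle, so the law of the continuation takes finitely many values and one data structure serves
-- all particles. The time bounds distinguish three endings: halting by time or budget is paid for
-- by the old set alone, continuing by the increment of the cost, and halting by small conductance
-- also by the volume of the new set, which is output.
open Classical in
theorem StoresBoundary.exists_reduces_afterDraw (hG : ∀ v, 0 < G.degree v)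
    {D : BoundarySet V} {S : Finset V} (h : StoresBoundary G D S) (θ : ℝ) (B left c : ℕ)
    (path : List (Finset V)) (N : Finset V) {S' : Finset V} (hS' : S' = nextSet G S N) {c' : ℕ}
    (hc' : c' = c + (vol G (symmDiff S' S) + cut G S)) :
    ∃ (D' : BoundarySet V) (out : List V) (t : ℕ),
      (∀ (X : V) (Z : ℝ), (∀ y, Z ≤ walkInto G y S ↔ y ∈ N) →
        Reduces G (afterDraw θ B left D X (vol G S) c S path Z) t
          (if Halts G θ B left S' c' then .ret ⟨path ++ [S'], out⟩
          else steps θ B left D' X (vol G S') c' S' (path ++ [S']))) ∧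
      (¬ Halts G θ B left S' c' → StoresBoundary G D' S' ∧
        t ≤ (14 * maxDepth V + 54) * (1 + cut G S + vol G (symmDiff S' S))) ∧
      (Halts G θ B left S' c' → out.Nodup ∧ out.toFinset = S' ∧
        ((left = 0 ∨ B < c') → t ≤ (14 * maxDepth V + 54) * (1 + cut G S + vol G S)) ∧
        (¬ (left = 0 ∨ B < c') →
          t ≤ (14 * maxDepth V + 54) * (1 + cut G S + vol G (symmDiff S' S) + vol G S'))) := by
  have hkeys : ∀ y, y ∈ D.boundary.toList.map Prod.fst ↔ y ∈ vertexBoundary G S := fun y => by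
    rw [h.stores.boundary.mem_keys, isSome_boundaryEntry]
  have hlen : D.boundary.toList.length = (vertexBoundary G S).card := by
    rw [← List.length_map (f := Prod.fst),
      ← List.toFinset_card_of_nodup h.stores.boundary.nodup_keys]
    congr 1
    ext y
    rw [List.mem_toFinset, hkeys]
  have hbd := card_vertexBoundary_le (G := G) S
  obtain ⟨t₁, ht₁, hr₁⟩ := computes_entries (G := G) D.boundary
  rw [RBNode.size_eq, hlen] at ht₁
  obtain ⟨L, t₂, hL, hmem, ht₂, hr₂⟩ := h.exists_reduces_select N D.boundary.toList
    h.stores.boundary.nodup_keys [] List.nodup_nil (by simp) (c + D.cutSize)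
  rw [hlen] at ht₂
  have hLset : L.toFinset = symmDiff S' S := by
    rw [hS', symmDiff_nextSet]
    ext y
    rw [List.mem_toFinset, hmem, hkeys, Finset.mem_filter]
    simp
  have hSL : symmDiff S L.toFinset = S' := by
    rw [hLset, symmDiff_comm S' S, symmDiff_symmDiff_cancel_left]
  have hLlen : L.length ≤ (vertexBoundary G S).card := by
    rw [← List.toFinset_card_of_nodup hL, hLset, hS', symmDiff_nextSet]
    exact Finset.card_filter_le _ _
  have hcard : S'.card ≤ vol G S + (vertexBoundary G S).card := by
    calc S'.card ≤ S.card + L.toFinset.card := by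
          rw [← hSL]
          refine (Finset.card_le_card (t := S ∪ L.toFinset) ?_).trans (Finset.card_union_le _ _)
          exact symmDiff_le_sup
      _ ≤ _ := add_le_add (card_le_vol hG S) ((List.toFinset_card_le L).trans hLlen)
  have hstart : ∀ (X : V) (Z : ℝ), (∀ y, Z ≤ walkInto G y S ↔ y ∈ N) →
      Reduces G (afterDraw θ B left D X (vol G S) c S path Z) (t₁ + (1 + (t₂ + 1)))
        (if (decide (left = 0) || decide (B < c')) = true then do
          let M ← toggleMembers L D.members
          finish (path ++ [S']) M
        else do
          let D' ← BoundarySet.toggleAll L D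
          let small ← Prog.op (decide ((D'.cutSize : ℝ) / (vol G S' : ℝ) < θ))
          if small then finish (path ++ [S']) D'.members
          else steps θ B left D' X (vol G S') c' S' (path ++ [S'])) := by
    intro X Z hZ
    rw [afterDraw]
    refine (hr₁.bind _).trans ((Reduces.op_bind _ _).trans ?_)
    have hsel := hr₂ Z hZ
    rw [List.toFinset_nil, ← Finset.bot_eq_empty, symmDiff_bot,
      show vol G (⊥ : Finset V) = 0 from rfl, Nat.add_zero, hSL, hLset, h.cutSize,
      show c + cut G S + vol G (symmDiff S' S) = c' by omega] at hsel
    rw [h.cutSize]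
    refine (hsel.bind _).trans ?_
    have := Reduces.op_bind (G := G) (decide (left = 0) || decide (B < c')) fun halt =>
        (if halt = true then do
          let M ← toggleMembers L D.members
          finish (path ++ [S']) M
        else do
          let D' ← BoundarySet.toggleAll L D
          let small ← Prog.op (decide ((D'.cutSize : ℝ) / (vol G S' : ℝ) < θ))
          if small then finish (path ++ [S']) D'.members
          else steps θ B left D' X (vol G S') c' S' (path ++ [S']))
    rw [← hSL] at this ⊢
    exact this
  -- Since |δ(S)| ≤ 2∂(S), `entries` takes at most 4∂(S) + 1 steps and `select` at most (4H +
  -- 18)·2∂(S) + 1, with H = `maxDepth V`.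
  have hsel_le : t₁ + (1 + (t₂ + 1)) ≤ (8 * maxDepth V + 40) * cut G S + 4 := by
    have : (4 * maxDepth V + 18) * (vertexBoundary G S).card ≤
        (4 * maxDepth V + 18) * (2 * cut G S) := Nat.mul_le_mul_left _ hbd
    ring_nf at this ht₂ ⊢
    omega
  by_cases hhalt : left = 0 ∨ B < c'
  · have hH : Halts G θ B left S' c' := .inl hhalt
    obtain ⟨M, hM, t₃, ht₃, hr₃⟩ := h.stores.members.computes_toggleMembers (G := G) L hL
    rw [hSL] at hM
    obtain ⟨out, hnd, hout, t₄, ht₄, hr₄⟩ := hM.computes_finish (G := G) (path ++ [S'])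
    refine ⟨D, out, t₁ + (1 + (t₂ + 1)) + (t₃ + t₄), fun X Z hZ => ?_, fun H => absurd hH H,
      fun _ => ⟨hnd, hout, fun _ => ?_, fun H => absurd hhalt H⟩⟩
    · refine (hstart X Z hZ).trans ?_
      rw [if_pos hH, if_pos (by simpa using hhalt)]
      exact (hr₃.bind _).trans hr₄
    · have : (3 * maxDepth V + 4) * L.length ≤ (3 * maxDepth V + 4) * (2 * cut G S) :=
        Nat.mul_le_mul_left _ (hLlen.trans hbd)
      -- The coefficient of ∂(S) is (8H + 40) + 2(3H + 4) + 6 = 14H + 54, the origin of the constant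
      -- in the statement.
      calc _ ≤ (8 * maxDepth V + 40) * cut G S + 4 + ((3 * maxDepth V + 4) * (2 * cut G S) + 1 +
            (3 * (vol G S + 2 * cut G S) + 3)) := by omega
        _ ≤ _ := by nlinarith
  · obtain ⟨D', hD', t₃, ht₃, hr₃⟩ := h.computes_toggleAll hG L hL
    rw [hSL] at hD'
    rw [hLset] at ht₃
    obtain ⟨out, hnd, hout, t₄, ht₄, hr₄⟩ :=
      hD'.stores.members.computes_finish (G := G) (path ++ [S'])
    have hmid : ∀ (X : V) (Z : ℝ), (∀ y, Z ≤ walkInto G y S ↔ y ∈ N) →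
        Reduces G (afterDraw θ B left D X (vol G S) c S path Z)
          (t₁ + (1 + (t₂ + 1)) + (t₃ + 1))
          (if decide (conductance G S' < θ) = true then finish (path ++ [S']) D'.members
          else steps θ B left D' X (vol G S') c' S' (path ++ [S'])) := by
      intro X Z hZ
      refine (hstart X Z hZ).trans ?_
      rw [if_neg (by simpa using hhalt)]
      refine (hr₃.bind _).trans ?_
      rw [conductance, ← hD'.cutSize]
      exact Reduces.op_bind (decide ((D'.cutSize : ℝ) / (vol G S' : ℝ) < θ)) fun small =>
        if small = true then finish (path ++ [S']) D'.members
          else steps θ B left D' X (vol G S') c' S' (path ++ [S'])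
    by_cases hs : conductance G S' < θ
    · have hH : Halts G θ B left S' c' := .inr hs
      refine ⟨D', out, t₁ + (1 + (t₂ + 1)) + (t₃ + 1) + t₄, fun X Z hZ => ?_,
        fun H => absurd hH H, fun _ => ⟨hnd, hout, fun H => absurd H hhalt, fun _ => ?_⟩⟩
      · refine (hmid X Z hZ).trans ?_
        rw [if_pos hH, if_pos (by simpa using hs)]
        exact hr₄
      · have := card_le_vol hG S'
        calc _ ≤ (8 * maxDepth V + 40) * cut G S + 4 +
              ((13 * maxDepth V + 42) * vol G (symmDiff S' S) + 1 + 1) +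
              (3 * vol G S' + 3) := by omega
          _ ≤ _ := by nlinarith
    · have hH : ¬ Halts G θ B left S' c' := fun H => H.elim hhalt hs
      refine ⟨D', [], t₁ + (1 + (t₂ + 1)) + (t₃ + 1), fun X Z hZ => ?_,
        fun _ => ⟨hD', ?_⟩, fun H => absurd H hH⟩
      · have := hmid X Z hZ
        rw [if_neg (by simpa using hs)] at this
        rwa [if_neg hH]
      · calc _ ≤ (8 * maxDepth V + 40) * cut G S + 4 +
              ((13 * maxDepth V + 42) * vol G (symmDiff S' S) + 1 + 1) := by omega
          _ ≤ _ := by nlinarith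

end Step

end EvoSet

namespace EvoSet

open MeasureTheory RBTree

/-! ## Stopping times -/

section Stopping

variable {V : Type} [Fintype V] [DecidableEq V] (G : SimpleGraph V) [DecidableRel G.Adj]

/-- The condition for stopping at time `t` in the definition of `tau`. -/
def StopsAt (T B : ℕ) (S : ℕ → Finset V) (t : ℕ) : Prop :=
  conductance G (S t) < theta G T ∨ t = T ∨ B < cost G S t

variable {G}

theorem cost_succ (S : ℕ → Finset V) (t : ℕ) :
    cost G S (t + 1) = cost G S t + (vol G (symmDiff (S (t + 1)) (S t)) + cut G (S t)) := by
  rw [cost, cost, Finset.sum_range_succ, add_assoc]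

theorem cost_congr {S S' : ℕ → Finset V} {t : ℕ} (h : ∀ j ≤ t, S j = S' j) :
    cost G S t = cost G S' t := by
  rw [cost, cost, h 0 (Nat.zero_le t)]
  congr 1
  refine Finset.sum_congr rfl fun j hj => ?_
  rw [h j (Finset.mem_range.1 hj).le, h (j + 1) (Finset.mem_range.1 hj)]

theorem stopsAt_congr {S S' : ℕ → Finset V} {t : ℕ} (h : ∀ j ≤ t, S j = S' j) (T B : ℕ) :
    StopsAt G T B S t ↔ StopsAt G T B S' t := by
  rw [StopsAt, StopsAt, h t le_rfl, cost_congr h]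

theorem tau_eq_of_stopsAt {T B t : ℕ} {S : ℕ → Finset V} (h : StopsAt G T B S t)
    (h' : ∀ j < t, ¬ StopsAt G T B S j) : tau G T B S = t :=
  le_antisymm (Nat.sInf_le h) (le_csInf ⟨t, h⟩ fun j hj => not_lt.1 fun hlt => h' j hlt hj)

theorem stopsAt_tau (T B : ℕ) (S : ℕ → Finset V) : StopsAt G T B S (tau G T B S) :=
  Nat.sInf_mem (s := {t | StopsAt G T B S t}) ⟨T, .inr (.inl rfl)⟩

theorem not_stopsAt_of_lt_tau {T B t : ℕ} {S : ℕ → Finset V} (h : t < tau G T B S) :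
    ¬ StopsAt G T B S t :=
  Nat.notMem_of_lt_sInf h

/-- The initial volume is charged, and each step changes the volume by at most that of the symmetric
difference, which is charged too. -/
theorem vol_le_cost (S : ℕ → Finset V) (t : ℕ) : vol G (S t) ≤ cost G S t := by
  induction t with
  | zero => simp [cost]
  | succ t ih =>
    rw [cost_succ]
    have := vol_le_vol_add_vol_symmDiff (G := G) (S t) (S (t + 1))
    omega

theorem update_apply_of_le (S : ℕ → Finset V) (U : Finset V) {t j : ℕ} (hj : j ≤ t) :
    Function.update S (t + 1) U j = S j :=
  Function.update_of_ne (by omega) _ _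

theorem cost_update (S : ℕ → Finset V) (U : Finset V) (t : ℕ) :
    cost G (Function.update S (t + 1) U) (t + 1) =
      cost G S t + (vol G (symmDiff U (S t)) + cut G (S t)) := by
  rw [cost_succ, Function.update_self, update_apply_of_le S U le_rfl,
    cost_congr fun j hj => update_apply_of_le S U hj]

theorem stopsAt_update (S : ℕ → Finset V) (U : Finset V) (T B : ℕ) {t j : ℕ} (hj : j ≤ t) :
    StopsAt G T B (Function.update S (t + 1) U) j ↔ StopsAt G T B S j :=
  stopsAt_congr (fun _ hi => update_apply_of_le S U (hi.trans hj)) T B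

theorem map_range_update (S : ℕ → Finset V) (U : Finset V) (t : ℕ) :
    (List.range (t + 1 + 1)).map (Function.update S (t + 1) U) =
      (List.range (t + 1)).map S ++ [U] := by
  rw [List.range_succ, List.map_append, List.map_singleton, Function.update_self]
  congr 1
  exact List.map_congr_left fun j hj =>
    update_apply_of_le S U (Nat.lt_succ_iff.1 (List.mem_range.1 hj))

theorem eq_of_map_range_eq {S S' : ℕ → Finset V} {m n : ℕ}
    (h : (List.range (m + 1)).map S = (List.range (n + 1)).map S') {j : ℕ} (hj : j ≤ n) :
    S j = S' j := by
  have hmn : m = n := by simpa using congrArg List.length h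
  subst hmn
  exact List.map_inj_left.1 h j (List.mem_range.2 (Nat.lt_succ_of_le hj))

theorem one_lt_card (hG : ∀ v, 0 < G.degree v) (x : V) : 1 < Fintype.card V := by
  obtain ⟨y, hy⟩ := (G.degree_pos_iff_exists_adj x).1 (hG x)
  exact Fintype.one_lt_card_iff.2 ⟨x, y, hy.ne⟩

theorem theta_pos (hG : ∀ v, 0 < G.degree v) (x : V) {T : ℕ} (hT : T ≠ 0) : 0 < theta G T := by
  have h₁ : 1 < vol G Finset.univ := (one_lt_card hG x).trans_le (card_le_vol hG Finset.univ)
  have h₂ : 0 < Real.log (vol G Finset.univ) := Real.log_pos (by exact_mod_cast h₁)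
  have : (0 : ℝ) < T := by exact_mod_cast Nat.pos_of_ne_zero hT
  rw [theta]
  positivity

/-- Before stopping, every step adds at least 1 to the cost, which absorbs the constant part of its
running time. -/
theorem cut_pos_of_theta_le {S : Finset V} {θ : ℝ} (hθ : 0 < θ) (h : ¬ conductance G S < θ) :
    0 < cut G S := by
  rcases Nat.eq_zero_or_pos (cut G S) with h0 | h0
  · exact absurd (by rwa [conductance, h0, Nat.cast_zero, zero_div]) h
  · exact h0

theorem vol_singleton (x : V) : vol G {x} = G.degree x := Finset.sum_singleton _ _

theorem cut_singleton (x : V) : cut G {x} = G.degree x := by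
  have h := cut_add_sum (G := G) {x}
  rw [Finset.sum_singleton, vol_singleton] at h
  have : edgesInto G x {x} = 0 := by simp [edgesInto, Finset.filter_singleton]
  omega

end Stopping

/-! ## The possible outcomes -/

section Outcomes

variable {V : Type} [Fintype V] [LinearOrder V] {G : SimpleGraph V} [DecidableRel G.Adj]

variable (V) in
/-- A bound for the ratio of the running time and the cost. -/
def timeFactor : ℕ := 2 * (17 * maxDepth V + 69)

theorem halts_iff_stopsAt (S : ℕ → Finset V) (U : Finset V) {T B t left : ℕ}
    (ht : t + (left + 1) = T) :
    Halts G (theta G T) B left U (cost G (Function.update S (t + 1) U) (t + 1)) ↔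
      StopsAt G T B (Function.update S (t + 1) U) (t + 1) := by
  rw [Halts, StopsAt, Function.update_self, show left = 0 ↔ t + 1 = T by omega]
  exact or_comm

theorem Outcome.eq_of_ret {α : Type} {a : α} {r : Run α} (h : Outcome G (.ret a) r) :
    r = ⟨a, 0⟩ := by
  cases h
  rfl

theorem Outcome.walkStep {β : Type} {X : V} {f : V → Prog V β} {r : Run β}
    (h : Outcome G (EvoSet.walkStep X >>= f) r) :
    ∃ (X' : V) (r' : Run β) (t : ℕ), Outcome G (f X') r' ∧ t ≤ 4 ∧ r = r'.charge t := by
  cases h with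
  | coin b h =>
    cases h with
    | work h =>
      cases b with
      | true =>
        cases h with
        | work h => exact ⟨X, _, 1 + (1 + 1), h, by omega, by simp [Run.charge_charge]⟩
      | false =>
        cases h with
        | randomNeighbor hu h =>
          cases h with
          | work h => exact ⟨_, _, 1 + (1 + (1 + 1)), h, by omega, by simp [Run.charge_charge]⟩

/-- The summand `timeFactor V * c` reserves time for the earlier steps. The last step fits into
twice that amount because ∂(S) ≤ μ(S) ≤ `c`; the volume of its symmetric difference does not enter.
-/
theorem halting_time_le {t₁ t₂ t₃ a v c : ℕ} (h₁ : t₁ ≤ 4) (h₂ : t₂ ≤ 3 * maxDepth V + 10)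
    (h₃ : t₃ ≤ (14 * maxDepth V + 54) * (1 + a + v)) (ha : 0 < a) (hav : a ≤ v) (hvc : v ≤ c) :
    t₁ + (t₂ + (2 + (t₃ + 0))) + timeFactor V * c ≤ 3 * timeFactor V * c := by
  have h₄ : (14 * maxDepth V + 54) * (1 + a + v) ≤ (14 * maxDepth V + 54) * (3 * c) :=
    Nat.mul_le_mul_left _ (by omega)
  have h₅ : 3 * maxDepth V + 16 ≤ (3 * maxDepth V + 16) * c :=
    Nat.le_mul_of_pos_right _ (by omega)
  rw [timeFactor]
  generalize maxDepth V = H at *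
  nlinarith

theorem stopping_time_le {t₁ t₂ t₃ a b v c : ℕ} (h₁ : t₁ ≤ 4) (h₂ : t₂ ≤ 3 * maxDepth V + 10)
    (h₃ : t₃ ≤ (14 * maxDepth V + 54) * (1 + a + b + v)) (ha : 0 < a) (hvc : v ≤ c + (b + a)) :
    t₁ + (t₂ + (2 + (t₃ + 0))) + timeFactor V * c ≤ 3 * timeFactor V * (c + (b + a)) := by
  have h₄ : (14 * maxDepth V + 54) * (1 + a + b + v) ≤
      (14 * maxDepth V + 54) * (3 * (c + (b + a))) := Nat.mul_le_mul_left _ (by omega)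
  have h₅ : 3 * maxDepth V + 16 ≤ (3 * maxDepth V + 16) * (c + (b + a)) :=
    Nat.le_mul_of_pos_right _ (by omega)
  rw [timeFactor]
  generalize maxDepth V = H at *
  nlinarith

/-- The step is paid for by the cost `b + a` that it adds; as `a` is positive, the constant terms
are also multiples of `b + a`. -/
theorem continuing_time_le {t₁ t₂ t₃ t₄ a b c : ℕ} (h₁ : t₁ ≤ 4)
    (h₂ : t₂ ≤ 3 * maxDepth V + 10) (h₃ : t₃ ≤ (14 * maxDepth V + 54) * (1 + a + b))
    (ha : 0 < a) :
    t₁ + (t₂ + (2 + (t₃ + t₄))) + timeFactor V * c ≤ t₄ + timeFactor V * (c + (b + a)) := by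
  have h₄ : (14 * maxDepth V + 54) * (1 + a + b) ≤ (14 * maxDepth V + 54) * (2 * (b + a)) :=
    Nat.mul_le_mul_left _ (by omega)
  have h₅ : 3 * maxDepth V + 16 ≤ (3 * maxDepth V + 16) * (b + a) :=
    Nat.le_mul_of_pos_right _ (by omega)
  rw [timeFactor]
  generalize maxDepth V = H at *
  nlinarith

/-- Amortized analysis with the potential `timeFactor V * cost G S t`: a continuing step uses at
most the potential that it adds, and the last step at most twice the final potential or, if it halts
by time or budget, twice the potential before it. Hence the factor 3. -/
theorem StoresBoundary.outcome_steps (hG : ∀ v, 0 < G.degree v) {T B : ℕ} (hT : T ≠ 0)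
    (left : ℕ) {D : BoundarySet V} (X : V) (S : ℕ → Finset V) (t : ℕ) (ht : t + (left + 1) = T)
    (h : StoresBoundary G D (S t)) (hS : ∀ j ≤ t, ¬ StopsAt G T B S j) {r : Run (Sample V)}
    (hr : Outcome G (steps (theta G T) B (left + 1) D X (vol G (S t)) (cost G S t) (S t)
      ((List.range (t + 1)).map S)) r) :
    ∃ S' : ℕ → Finset V, (∀ j ≤ t, S' j = S j) ∧
      r.result.path = (List.range (tau G T B S' + 1)).map S' ∧
      r.result.output.Nodup ∧ r.result.output.toFinset = S' (tau G T B S') ∧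
      r.time + timeFactor V * cost G S t ≤
        3 * timeFactor V * min B (cost G S' (tau G T B S')) := by
  induction left using Nat.strong_induction_on generalizing D X S t r with
  | _ left ih =>
  have hθ : 0 < theta G T := theta_pos hG X hT
  have hcut : 0 < cut G (S t) := cut_pos_of_theta_le hθ fun h' => hS t le_rfl (.inl h')
  have hcB : cost G S t ≤ B := not_lt.1 fun h' => hS t le_rfl (.inr (.inr h'))
  have hvol := vol_le_cost (G := G) S t
  rw [steps_succ] at hr
  obtain ⟨X', r₁, t₁, hr₁, ht₁, rfl⟩ := hr.walkStep
  obtain ⟨t₂, ht₂, hprob⟩ := h.computes_prob X'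
  obtain ⟨r₂, hr₂, rfl⟩ := (hprob.bind _).outcome hr₁
  obtain ⟨Z, r₃, hr₃, rfl⟩ : ∃ Z r₃, Outcome G (afterDraw (theta G T) B left D X' (vol G (S t))
      (cost G S t) (S t) ((List.range (t + 1)).map S) Z) r₃ ∧ r₂ = r₃.charge 2 := by
    cases hr₂ with
    | uniform hz hr₃ =>
      cases hr₃ with
      | work hr₄ => exact ⟨_, _, hr₄, by simp [Run.charge_charge]⟩
  -- The path records what the algorithm computes, which may differ from `evolve G (S t) Z` for the
  -- threshold `Z = 0`. The bounds thus hold on every run and no exceptional event has to be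
  -- removed.
  generalize hU : nextSet G (S t) (evolve G (S t) Z) = U
  set S₁ := Function.update S (t + 1) U with hS₁
  have hagree : ∀ j ≤ t, S₁ j = S j := fun j hj => update_apply_of_le S U hj
  have hnew : S₁ (t + 1) = U := Function.update_self _ _ _
  have hcost := cost_update (G := G) S U t
  have hpath := map_range_update S U t
  rw [← hS₁] at hcost hpath
  have hnot : ∀ j < t + 1, ¬ StopsAt G T B S₁ j := fun j hj =>
    (stopsAt_update S U T B (Nat.lt_succ_iff.1 hj)).not.2 (hS j (Nat.lt_succ_iff.1 hj))
  obtain ⟨D', out, t₃, hred, hgo, hend⟩ := h.exists_reduces_afterDraw hG (theta G T) B left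
    (cost G S t) ((List.range (t + 1)).map S) (evolve G (S t) Z) hU.symm hcost
  have hhalts := halts_iff_stopsAt (G := G) S U (T := T) (B := B) (left := left) ht
  rw [← hS₁] at hhalts
  obtain ⟨r₄, hr₄, rfl⟩ := (hred X' Z fun y => by simp [evolve]).outcome hr₃
  simp only [Run.charge]
  by_cases hH : Halts G (theta G T) B left U (cost G S₁ (t + 1))
  · rw [if_pos hH] at hr₄
    obtain rfl : r₄ = ⟨⟨(List.range (t + 1)).map S ++ [U], out⟩, 0⟩ := hr₄.eq_of_ret
    obtain ⟨hnd, hout, hb₁, hb₂⟩ := hend hH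
    have htau := tau_eq_of_stopsAt (hhalts.1 hH) hnot
    refine ⟨S₁, hagree, ?_, hnd, ?_, ?_⟩
    · rw [htau, hpath]
    · rw [htau, hnew, hout]
    · rw [htau, hcost]
      by_cases hlast : left = 0 ∨ B < cost G S₁ (t + 1)
      · have hb := hb₁ hlast
        -- The final cost may exceed B, but the cost before this step is below both terms of the
        -- minimum.
        have hmin : cost G S t ≤ min B (cost G S t + (vol G (symmDiff U (S t)) + cut G (S t))) :=
          le_min hcB (Nat.le_add_right _ _)
        refine le_trans ?_ (Nat.mul_le_mul_left _ hmin)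
        exact halting_time_le ht₁ ht₂ hb hcut (cut_le_vol _) hvol
      · have hb := hb₂ hlast
        rw [hcost] at hlast
        -- The budget is not exceeded, so the minimum is the final cost and the volume of the new
        -- set may be charged to it.
        rw [min_eq_right (by omega)]
        exact stopping_time_le ht₁ ht₂ hb hcut
          ((vol_le_vol_add_vol_symmDiff (S t) U).trans (by omega))
  · rw [if_neg hH] at hr₄
    obtain ⟨hD', hb⟩ := hgo hH
    obtain ⟨l, rfl⟩ : ∃ l, left = l + 1 :=
      Nat.exists_eq_succ_of_ne_zero fun h0 => hH (.inl (.inl h0))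
    rw [← hpath, ← hnew] at hr₄
    obtain ⟨S', hS', hp, hnd, hout, htime⟩ := ih l (Nat.lt_succ_self l) X' S₁ (t + 1) (by omega)
      (hnew ▸ hD') (fun j hj => by
        rcases Nat.lt_or_eq_of_le hj with hj | rfl
        · exact hnot j hj
        · exact fun hs => hH (hhalts.2 hs)) hr₄
    refine ⟨S', fun j hj => (hS' j (by omega)).trans (hagree j hj), hp, hnd, hout, ?_⟩
    refine le_trans ?_ htime
    rw [hcost]
    exact continuing_time_le ht₁ ht₂ hb hcut

-- The bound by the degree starts the amortization at cost d(x). The constant bound is needed when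
-- the run stops at time 0, where max(1, B) can be smaller than d(x).
open Classical in
theorem exists_reduces_generateSample (hG : ∀ v, 0 < G.degree v) (x : V) (T B : ℕ)
    {S : ℕ → Finset V} (hS : S 0 = {x}) :
    ∃ (D : BoundarySet V) (t : ℕ), StoresBoundary G D {x} ∧
      Reduces G (generateSample x T B) t (if StopsAt G T B S 0 then .ret ⟨[{x}], [x]⟩
        else steps (theta G T) B T D x (G.degree x) (G.degree x) {x} [{x}]) ∧
      t ≤ timeFactor V * G.degree x ∧ (StopsAt G T B S 0 → t ≤ timeFactor V) := by
  obtain ⟨D, hD, t, ht, hr⟩ := (storesBoundary_empty (G := G)).computes_toggle x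
  rw [← Finset.bot_eq_empty, bot_symmDiff] at hD
  have hx := hG x
  have hK : timeFactor V = 2 * (17 * maxDepth V + 69) := rfl
  have hdeg : (G.degree x : ℝ) / (G.degree x : ℝ) = conductance G (S 0) := by
    rw [hS, conductance, vol_singleton, cut_singleton]
  have hcost : G.degree x = cost G S 0 := by simp [cost, hS, vol_singleton]
  have hhalt : (decide ((G.degree x : ℝ) / (G.degree x : ℝ) < theta G T) || decide (T = 0) ||
      decide (B < G.degree x)) = true ↔ StopsAt G T B S 0 := by
    rw [StopsAt, ← hdeg, ← hcost, @eq_comm _ 0 T]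
    simp only [Bool.or_eq_true, decide_eq_true_eq, or_assoc]
  have h₁ : Reduces G (generateSample x T B) (2 + (2 + (1 + 1)))
      (if (decide ((G.degree x : ℝ) / (G.degree x : ℝ) < theta G T) || decide (T = 0) ||
          decide (B < G.degree x)) = true then Prog.op ⟨[{x}], [x]⟩
      else do
        let S ← BoundarySet.toggle ⟨.nil, .nil, 0⟩ x
        steps (theta G T) B T S x (G.degree x) (G.degree x) {x} [{x}]) :=
    (Reduces.degree_bind _ _).trans ((Reduces.totalVolume_bind _).trans
      ((Reduces.op_bind _ _).trans (Reduces.op_bind _ _)))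
  by_cases h : StopsAt G T B S 0
  · refine ⟨D, _, hD, h₁.trans (d := 1 + 0) ?_, ?_, fun _ => by omega⟩
    · rw [if_pos (hhalt.2 h), if_pos h]
      exact .work (.refl _)
    · rw [hK]
      nlinarith
  · refine ⟨D, _, hD, h₁.trans (d := t) ?_, ?_, fun h' => absurd h' h⟩
    · rw [if_neg (fun h' => h (hhalt.1 h')), if_neg h]
      exact hr.bind _
    · rw [hK]
      nlinarith

theorem outcome_generateSample (hG : ∀ v, 0 < G.degree v) (x : V) (T B : ℕ) {r : Run (Sample V)}
    (hr : Outcome G (generateSample x T B) r) :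
    ∃ S : ℕ → Finset V, S 0 = {x} ∧
      r.result.path = (List.range (tau G T B S + 1)).map S ∧
      r.result.output.Nodup ∧ r.result.output.toFinset = S (tau G T B S) ∧
      r.time ≤ 3 * timeFactor V * min (max 1 B) (cost G S (tau G T B S)) := by
  obtain ⟨D, t, hD, hred, ht, ht'⟩ := exists_reduces_generateSample hG x T B (S := fun _ => {x}) rfl
  obtain ⟨r, hr', rfl⟩ := hred.outcome hr
  have hx := hG x
  have hcost : cost G (fun _ => {x}) 0 = G.degree x := by simp [cost, vol_singleton]
  by_cases h : StopsAt G T B (fun _ => {x}) 0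
  · rw [if_pos h] at hr'
    obtain rfl := hr'.eq_of_ret
    have htau := tau_eq_of_stopsAt h (by simp)
    refine ⟨fun _ => {x}, rfl, ?_, List.nodup_singleton x, ?_, ?_⟩
    · rw [htau]; rfl
    · simp [Run.charge]
    · rw [htau, hcost]
      simp only [Run.charge, Nat.add_zero]
      have h1 : 1 ≤ min (max 1 B) (G.degree x) := le_min (le_max_left 1 B) hx
      have := ht' h
      nlinarith
  · rw [if_neg h] at hr'
    have hT : T ≠ 0 := fun hT => h (.inr (.inl hT.symm))
    obtain ⟨left, rfl⟩ := Nat.exists_eq_succ_of_ne_zero hT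
    obtain ⟨S, hS, hp, hnd, hout, htime⟩ := hD.outcome_steps hG hT left x (fun _ => {x}) 0
      (by omega) (fun j hj => by rwa [Nat.le_zero.1 hj]) (by
        rw [vol_singleton]; simpa [hcost] using hr')
    refine ⟨S, hS 0 le_rfl, hp, hnd, hout, ?_⟩
    rw [hcost] at htime
    refine le_trans ?_ (Nat.mul_le_mul_left _ (min_le_min_right _ (le_max_right 1 B)))
    refine le_trans ?_ htime
    simp only [Run.charge]
    omega

end Outcomes

end EvoSet

namespace EvoSet

open MeasureTheory RBTree

open scoped ENNReal

/-! ## The distribution of one step -/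

section Distribution

variable {V : Type} [Fintype V] [LinearOrder V] {G : SimpleGraph V} [DecidableRel G.Adj]

variable (G) in
/-- The probability that the result of `p` is in `A`. -/
noncomputable def resultProb {α : Type} (p : Prog V α) (A : Set α) : ℝ≥0∞ :=
  p.law G {r | r.result ∈ A}

theorem map_charge_apply {α : Type} (μ : Measure (Run α)) (c : ℕ) (A : Set α) :
    μ.map (Run.charge c) {r | r.result ∈ A} = μ {r | r.result ∈ A} := by
  rw [Measure.map_apply measurable_from_top MeasurableSpace.measurableSet_top]
  rfl

theorem Reduces.resultProb {α : Type} {p q : Prog V α} {c : ℕ} (h : Reduces G p c q)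
    (A : Set α) : resultProb G p A = resultProb G q A := by
  rw [EvoSet.resultProb, h.law, map_charge_apply, EvoSet.resultProb]

theorem resultProb_ret {α : Type} {a : α} {A : Set α} (h : a ∈ A) :
    resultProb G (.ret a) A = 1 := by
  rw [resultProb, Prog.law, Measure.dirac_apply' _ MeasurableSpace.measurableSet_top]
  exact Set.indicator_of_mem (by exact h) _

theorem resultProb_eq_zero {α : Type} {p : Prog V α} {A : Set α}
    (h : ∀ r, Outcome G p r → r.result ∉ A) : resultProb G p A = 0 :=
  measure_mono_null (fun r hr hr' => h r hr' hr) (ae_iff.1 (ae_outcome (G := G) p))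

theorem walk_nonneg (y z : V) : 0 ≤ walk G y z := by
  rw [walk]
  split_ifs <;> positivity

/-- Detailed balance: on an edge both sides are 1/2. -/
theorem degree_mul_walk_comm (hG : ∀ v, 0 < G.degree v) (y z : V) :
    (G.degree y : ℝ) * walk G y z = (G.degree z : ℝ) * walk G z y := by
  have hy : (G.degree y : ℝ) ≠ 0 := by exact_mod_cast (hG y).ne'
  have hz : (G.degree z : ℝ) ≠ 0 := by exact_mod_cast (hG z).ne'
  rw [walk, walk]
  simp only [G.adj_comm z y, eq_comm (a := z)]
  split_ifs with h₁ h₂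
  · field_simp
  · rw [h₂]
  · simp

theorem resultProb_walkStep {β : Type} (X : V) (f : V → Prog V β) (A : Set β) :
    resultProb G (walkStep X >>= f) A =
      ∑ X', ENNReal.ofReal (walk G X X') * resultProb G (f X') A := by
  have h₁ : resultProb G (Prog.op X >>= f) A = resultProb G (f X) A :=
    (Reduces.op_bind X f).resultProb A
  have h₂ : resultProb G (Prog.randomNeighbor X Prog.op >>= f) A =
      ∑ u ∈ G.neighborFinset X, (G.degree X : ℝ≥0∞)⁻¹ * resultProb G (f u) A := by
    have h : ∀ u, resultProb G (Prog.op u >>= f) A = resultProb G (f u) A :=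
      fun u => (Reduces.op_bind u f).resultProb A
    change Measure.map (Run.charge 1) (∑ u ∈ G.neighborFinset X, (G.degree X : ℝ≥0∞)⁻¹ •
      (Prog.op u >>= f).law G) _ = _
    rw [map_charge_apply, Measure.finsetSum_apply]
    refine Finset.sum_congr rfl fun u _ => ?_
    rw [Measure.smul_apply, smul_eq_mul, ← h u, resultProb]
  have h₃ : resultProb G (walkStep X >>= f) A = 2⁻¹ * resultProb G (Prog.op X >>= f) A +
      2⁻¹ * resultProb G (Prog.randomNeighbor X Prog.op >>= f) A := by
    change Measure.map (Run.charge 1)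
      ((2 : ℝ≥0∞)⁻¹ • (Prog.work (Prog.op X >>= f)).law G +
        (2 : ℝ≥0∞)⁻¹ • (Prog.work (Prog.randomNeighbor X Prog.op >>= f)).law G) _ = _
    rw [map_charge_apply, Measure.add_apply, Measure.smul_apply, Measure.smul_apply, Prog.law,
      map_charge_apply, Prog.law, map_charge_apply]
    rfl
  have hw : ∀ X', ENNReal.ofReal (walk G X X') =
      (if G.Adj X X' then 2⁻¹ * (G.degree X : ℝ≥0∞)⁻¹ else 0) + if X = X' then 2⁻¹ else 0 := by
    intro X'
    have h2 : ENNReal.ofReal (1 / 2) = 2⁻¹ := by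
      rw [one_div, ENNReal.ofReal_inv_of_pos two_pos, ENNReal.ofReal_ofNat]
    rw [walk]
    by_cases h : G.Adj X X'
    · have hd : 0 < G.degree X := (G.degree_pos_iff_exists_adj X).2 ⟨X', h⟩
      rw [if_pos h, if_pos h, if_neg h.ne, add_zero, one_div,
        ENNReal.ofReal_inv_of_pos (by positivity), ENNReal.ofReal_mul two_pos.le,
        ENNReal.ofReal_ofNat, ENNReal.ofReal_natCast,
        ENNReal.mul_inv (.inl two_ne_zero) (.inl ENNReal.ofNat_ne_top)]
    · rw [if_neg h, if_neg h, zero_add]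
      split_ifs
      · exact h2
      · exact ENNReal.ofReal_zero
  rw [h₃, h₁, h₂]
  simp only [hw, add_mul, Finset.sum_add_distrib, ite_mul, zero_mul, Finset.sum_ite_eq,
    Finset.mem_univ, if_true]
  rw [add_comm, ← Finset.sum_filter, Finset.mul_sum]
  congr 1
  refine Finset.sum_congr (by ext; simp) fun u _ => by rw [mul_assoc]

variable (G) in
/-- The thresholds that lead from `S` to `N`. -/
def thresholds (S N : Finset V) : Set ℝ := {z | evolve G S z = N}

theorem mem_thresholds_iff {S N : Finset V} {z : ℝ} :
    z ∈ thresholds G S N ↔ ∀ y, z ≤ walkInto G y S ↔ y ∈ N := by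
  rw [thresholds, Set.mem_ofPred_eq, Finset.ext_iff]
  simp [evolve]

theorem measurableSet_thresholds (S N : Finset V) : MeasurableSet (thresholds G S N) := by
  have : thresholds G S N = ⋂ y, {z | z ≤ walkInto G y S ↔ y ∈ N} := by
    ext z
    rw [mem_thresholds_iff, Set.mem_iInter]
    rfl
  rw [this]
  refine MeasurableSet.iInter fun y => ?_
  by_cases hy : y ∈ N
  · simp only [hy, iff_true]
    exact measurableSet_Iic
  · simp only [hy, iff_false, not_le]
    exact measurableSet_Ioi

/-- The law of the continuation is a step function of the threshold with finitely many measurable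
pieces. This gives the measurability that `Measure.bind` requires and turns the integral into a sum
over successor sets. -/
theorem resultProb_uniform {α : Type} {S : Finset V} {q : ℝ} {g : ℝ → Prog V α}
    {F : Finset V → Measure (Run α)} (hg : ∀ z, (g z).law G = F (evolve G S z)) (A : Set α) :
    resultProb G (Prog.uniform q Prog.op >>= g) A =
      ∑ N, (ENNReal.ofReal q)⁻¹ * volume (Set.Icc 0 q ∩ thresholds G S N) *
        F N {r | r.result ∈ A} := by
  set E : Set (Run α) := {r | r.result ∈ A}
  have hlaw : ∀ z, (Prog.op z >>= g).law G = (F (evolve G S z)).map (Run.charge 1) := fun z => by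
    rw [← hg z]
    rfl
  have hmeas : Measurable fun z => (Prog.op z >>= g).law G := by
    intro s _
    have : (fun z => (Prog.op z >>= g).law G) ⁻¹' s =
        ⋃ N ∈ {N | (F N).map (Run.charge 1) ∈ s}, thresholds G S N := by
      ext z
      simp [hlaw, thresholds]
    rw [this]
    exact MeasurableSet.biUnion (Set.to_countable _) fun N _ => measurableSet_thresholds S N
  have hE : ∀ z, (Prog.op z >>= g).law G E =
      ∑ N, (thresholds G S N).indicator (fun _ => F N E) z := by
    intro z
    rw [hlaw, map_charge_apply, Finset.sum_eq_single (evolve G S z)]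
    · rw [Set.indicator_of_mem (s := thresholds G S (evolve G S z)) (by rfl)]
    · intro N _ hN
      exact Set.indicator_of_notMem (s := thresholds G S N) (fun h => hN (Eq.symm h)) _
    · simp
  change Measure.map (Run.charge 1) (Measure.bind (ProbabilityTheory.cond volume (Set.Icc 0 q))
    fun z => (Prog.op z >>= g).law G) E = _
  rw [map_charge_apply, Measure.bind_apply MeasurableSpace.measurableSet_top hmeas.aemeasurable]
  change ∫⁻ z, (Prog.op z >>= g).law G E ∂_ = _
  simp only [hE]
  rw [lintegral_finsetSum _ fun N _ => measurable_const.indicator (measurableSet_thresholds S N)]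
  refine Finset.sum_congr rfl fun N _ => ?_
  rw [lintegral_indicator_const (measurableSet_thresholds S N),
    ProbabilityTheory.cond_apply measurableSet_Icc, Real.volume_Icc, sub_zero, mul_comm]

/-- In the continuing case `D'` is obtained before the particle is quantified, so the continuations
for all particles can later be averaged over one data structure. -/
theorem StoresBoundary.exists_resultProb_steps (hG : ∀ v, 0 < G.degree v)
    {D : BoundarySet V} {S : Finset V} (h : StoresBoundary G D S) (θ : ℝ) (B left c : ℕ)
    (path : List (Finset V)) :
    ∃ Q : Finset V → V → Prog V (Sample V),
      (∀ N X, let S' := nextSet G S N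
        let c' := c + (vol G (symmDiff S' S) + cut G S)
        (Halts G θ B left S' c' → ∃ out, Q N X = .ret ⟨path ++ [S'], out⟩) ∧
        (¬ Halts G θ B left S' c' → ∃ D', StoresBoundary G D' S' ∧
          Q N = fun X => steps θ B left D' X (vol G S') c' S' (path ++ [S']))) ∧
      ∀ X A, resultProb G (steps θ B (left + 1) D X (vol G S) c S path) A =
        ∑ X', ENNReal.ofReal (walk G X X') * ∑ N, (ENNReal.ofReal (walkInto G X' S))⁻¹ *
          volume (Set.Icc 0 (walkInto G X' S) ∩ thresholds G S N) * resultProb G (Q N X') A := by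
  classical
  choose D' out t hred hgo hend using fun N =>
    h.exists_reduces_afterDraw hG θ B left c path N rfl rfl
  set Q : Finset V → V → Prog V (Sample V) := fun N X =>
    if Halts G θ B left (nextSet G S N)
        (c + (vol G (symmDiff (nextSet G S N) S) + cut G S)) then
      .ret ⟨path ++ [nextSet G S N], out N⟩
    else steps θ B left (D' N) X (vol G (nextSet G S N))
      (c + (vol G (symmDiff (nextSet G S N) S) + cut G S)) (nextSet G S N)
      (path ++ [nextSet G S N]) with hQ
  refine ⟨Q, fun N X => ⟨fun hH => ⟨out N, if_pos hH⟩,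
    fun hH => ⟨D' N, (hgo N hH).1, funext fun X => if_neg hH⟩⟩, fun X A => ?_⟩
  · rw [steps_succ, resultProb_walkStep]
    refine Finset.sum_congr rfl fun X' _ => ?_
    obtain ⟨t₂, -, hprob⟩ := h.computes_prob X'
    rw [(hprob.bind _).resultProb]
    congr 1
    refine (resultProb_uniform (F := fun N => ((Q N X').law G).map (Run.charge (t N)))
      (fun z =>
      (hred (evolve G S z) X' z (mem_thresholds_iff.1 rfl)).law) A).trans ?_
    refine Finset.sum_congr rfl fun N _ => ?_
    rw [map_charge_apply]
    rfl

/-- Off the boundary, p(y, S) is 1 inside `S` and 0 outside, so a threshold in (0, 1] changes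
nothing there. At threshold 0 this can fail, but that is a null event. -/
theorem nextSet_eq_self (hG : ∀ v, 0 < G.degree v) {S N : Finset V} {z : ℝ} (hz : 0 < z)
    (hz' : z ≤ 1) (h : z ∈ thresholds G S N) : nextSet G S N = N := by
  rw [mem_thresholds_iff] at h
  ext y
  rw [nextSet, Finset.mem_symmDiff, Finset.mem_filter, ← h y]
  by_cases hb : y ∈ vertexBoundary G S
  · by_cases hy : y ∈ S <;> simp [hb, hy]
  · by_cases hy : y ∈ S
    · simp [hb, hy, walkInto_eq_one (hG y) hy hb, hz']
    · simp [hb, hy, walkInto_eq_zero hy hb, hz]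

theorem exists_mem_thresholds {S N : Finset V} {q : ℝ}
    (h : volume (Set.Icc 0 q ∩ thresholds G S N) ≠ 0) :
    ∃ z, 0 < z ∧ z ≤ q ∧ z ∈ thresholds G S N := by
  by_contra! hn
  refine h (measure_mono_null (t := {0}) (fun z hz => ?_) Real.volume_singleton)
  by_contra h0
  exact hn z (lt_of_le_of_ne hz.1.1 (Ne.symm h0)) hz.1.2 hz.2

theorem nextSet_eq_self_of_volume_ne_zero (hG : ∀ v, 0 < G.degree v) {X : V} {S N : Finset V}
    (h : volume (Set.Icc 0 (walkInto G X S) ∩ thresholds G S N) ≠ 0) :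
    nextSet G S N = N ∧ X ∈ N := by
  obtain ⟨z, hz, hz', hzN⟩ := exists_mem_thresholds h
  exact ⟨nextSet_eq_self hG hz (hz'.trans (walkInto_le_one X S)) hzN,
    (mem_thresholds_iff.1 hzN X).1 hz'⟩

theorem sum_volume_thresholds (S : Finset V) (q : ℝ) :
    ∑ N, volume (Set.Icc 0 q ∩ thresholds G S N) = ENNReal.ofReal q := by
  rw [← measure_biUnion_finset (fun N _ N' _ hN => ?_)
    fun N _ => measurableSet_Icc.inter (measurableSet_thresholds S N)]
  · have : ⋃ N ∈ (Finset.univ : Finset (Finset V)), Set.Icc 0 q ∩ thresholds G S N =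
        Set.Icc 0 q := by
      ext z
      simp [thresholds]
    rw [this, Real.volume_Icc, sub_zero]
  · refine Set.disjoint_left.2 fun z hz hz' => hN ?_
    exact (Eq.symm hz.2).trans hz'.2

/-- A threshold leading to `N` is at most p(X, S) exactly when X lies in `N`. So the interval [0,
p(X, S)] contains all nonnegative thresholds that lead to `N`, or none. -/
theorem volume_thresholds (X : V) (S N : Finset V) :
    volume (Set.Icc 0 (walkInto G X S) ∩ thresholds G S N) =
      if X ∈ N then ENNReal.ofReal (espKernel G S N) else 0 := by
  split_ifs with hX
  · rw [espKernel, Measure.real, ENNReal.ofReal_toReal]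
    · congr 1
      ext z
      refine ⟨fun hz => ⟨⟨hz.1.1, hz.1.2.trans (walkInto_le_one X S)⟩, hz.2⟩,
        fun hz => ⟨⟨hz.1.1, (mem_thresholds_iff.1 hz.2 X).2 hX⟩, hz.2⟩⟩
    · exact ((measure_mono fun z hz => hz.1).trans_lt measure_Icc_lt_top).ne
  · have : Set.Icc 0 (walkInto G X S) ∩ thresholds G S N = ∅ :=
      Set.eq_empty_iff_forall_notMem.2 fun z hz =>
        hX ((mem_thresholds_iff.1 hz.2 X).1 hz.1.2)
    rw [this, measure_empty]

theorem sum_degree_mul_walk (hG : ∀ v, 0 < G.degree v) (S : Finset V) (y : V) :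
    ∑ X ∈ S, (G.degree X : ℝ≥0∞) * ENNReal.ofReal (walk G X y) =
      G.degree y * ENNReal.ofReal (walkInto G y S) := by
  have h : ∀ v w, (G.degree v : ℝ≥0∞) * ENNReal.ofReal (walk G v w) =
      ENNReal.ofReal (G.degree v * walk G v w) := fun v w => by
    rw [ENNReal.ofReal_mul (Nat.cast_nonneg _), ENNReal.ofReal_natCast]
  rw [walkInto, ENNReal.ofReal_sum_of_nonneg fun z _ => walk_nonneg y z, Finset.mul_sum]
  refine Finset.sum_congr rfl fun X _ => ?_
  rw [h, h, degree_mul_walk_comm hG]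

theorem sum_walk (hG : ∀ v, 0 < G.degree v) (X : V) :
    ∑ X', ENNReal.ofReal (walk G X X') = 1 := by
  rw [← ENNReal.ofReal_sum_of_nonneg fun z _ => walk_nonneg X z]
  change ENNReal.ofReal (walkInto G X Finset.univ) = 1
  rw [walkInto_eq_one (hG X) (Finset.mem_univ X), ENNReal.ofReal_one]
  have : edgesInto G X Finset.univ = G.degree X := by
    have := edgesInto_add_edgesInto_compl (G := G) X Finset.univ
    rwa [Finset.compl_univ, show edgesInto G X ∅ = 0 by simp [edgesInto], add_zero] at this
  simp [vertexBoundary, this]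

theorem walkInto_pos_of_walk_ne_zero (hG : ∀ v, 0 < G.degree v) {X X' : V} {S : Finset V}
    (hX : X ∈ S) (h : walk G X X' ≠ 0) : 0 < walkInto G X' S := by
  have h₁ : (G.degree X : ℝ) ≠ 0 := by exact_mod_cast (hG X).ne'
  have h₂ : walk G X' X ≠ 0 := fun h0 => by
    have := degree_mul_walk_comm hG X X'
    rw [h0, mul_zero] at this
    exact (mul_ne_zero h₁ h) this
  exact (lt_of_le_of_ne (walk_nonneg X' X) (Ne.symm h₂)).trans_le
    (Finset.single_le_sum (f := fun z => walk G X' z) (fun z _ => walk_nonneg X' z) hX)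

/-- The stationary average of the distributions of a step. -/
theorem sum_degree_mul_step (hG : ∀ v, 0 < G.degree v) (S : Finset V)
    (R : Finset V → V → ℝ≥0∞) :
    ∑ X ∈ S, (G.degree X : ℝ≥0∞) * ∑ X', ENNReal.ofReal (walk G X X') *
      ∑ N, (ENNReal.ofReal (walkInto G X' S))⁻¹ *
        volume (Set.Icc 0 (walkInto G X' S) ∩ thresholds G S N) * R N X' =
      ∑ N, ∑ X' ∈ N, (G.degree X' : ℝ≥0∞) * (ENNReal.ofReal (espKernel G S N) * R N X') := by
  have h₁ : ∀ X', ∑ X ∈ S, (G.degree X : ℝ≥0∞) * (ENNReal.ofReal (walk G X X') *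
      ∑ N, (ENNReal.ofReal (walkInto G X' S))⁻¹ *
        volume (Set.Icc 0 (walkInto G X' S) ∩ thresholds G S N) * R N X') =
      ∑ N, if X' ∈ N then
        (G.degree X' : ℝ≥0∞) * (ENNReal.ofReal (espKernel G S N) * R N X') else 0 := by
    intro X'
    simp only [← mul_assoc]
    -- By reversibility the sum over the old particle is d(X') p(X', S), and p(X', S) cancels
    -- against the normalization of the uniform draw.
    rw [← Finset.sum_mul, sum_degree_mul_walk hG, Finset.mul_sum]
    refine Finset.sum_congr rfl fun N _ => ?_
    rw [volume_thresholds]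
    split_ifs with hX'
    -- If p(X', S) = 0, its inverse is infinite and cannot be cancelled, but then the thresholds
    -- leading to `N` lie in {0} and K(S, N) = 0.
    · by_cases h0 : walkInto G X' S = 0
      · have := volume_thresholds (G := G) X' S N
        rw [h0, if_pos hX'] at this
        have h00 : ENNReal.ofReal (espKernel G S N) = 0 := by
          rw [← this]
          refine measure_mono_null (fun z hz => hz.1) ?_
          simp
        rw [h00]
        simp
      · have hpos : 0 < walkInto G X' S := lt_of_le_of_ne (walkInto_nonneg _ _) (Ne.symm h0)
        have hc : ENNReal.ofReal (walkInto G X' S) * (ENNReal.ofReal (walkInto G X' S))⁻¹ = 1 :=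
          ENNReal.mul_inv_cancel (by simpa using hpos) ENNReal.ofReal_ne_top
        calc _ = (G.degree X' : ℝ≥0∞) * (ENNReal.ofReal (walkInto G X' S) *
              (ENNReal.ofReal (walkInto G X' S))⁻¹) *
              ENNReal.ofReal (espKernel G S N) * R N X' := by ring
          _ = _ := by rw [hc, mul_one]
    · simp
  simp only [Finset.mul_sum (s := (Finset.univ : Finset V))]
  rw [Finset.sum_comm]
  simp only [h₁]
  rw [Finset.sum_comm]
  refine Finset.sum_congr rfl fun N _ => ?_
  rw [← Finset.sum_filter]
  simp

end Distribution

end EvoSet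

namespace EvoSet

open MeasureTheory RBTree

open scoped ENNReal

/-! ### The distribution of the generated path -/

section Main

variable {V : Type} [Fintype V] [LinearOrder V] {G : SimpleGraph V} [DecidableRel G.Adj]

/-- Mass would be lost on drawing from an interval [0, 0]. The invariant `X ∈ S` excludes this:
reversibility makes p(X', S) positive at every X' that the walk can reach, and the drawn set
contains X' almost surely. -/
theorem StoresBoundary.resultProb_steps_univ (hG : ∀ v, 0 < G.degree v) (θ : ℝ) (B left : ℕ)
    {D : BoundarySet V} {S : Finset V} (h : StoresBoundary G D S) {X : V} (hX : X ∈ S) (c : ℕ)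
    (path : List (Finset V)) :
    resultProb G (steps θ B (left + 1) D X (vol G S) c S path) Set.univ = 1 := by
  induction left using Nat.strong_induction_on generalizing D S X c path with
  | _ left ih =>
  obtain ⟨Q, hQ, hprob⟩ := h.exists_resultProb_steps hG θ B left c path
  rw [hprob, ← sum_walk hG X]
  refine Finset.sum_congr rfl fun X' _ => ?_
  by_cases hw : walk G X X' = 0
  · rw [hw, ENNReal.ofReal_zero, zero_mul]
  have hpos := walkInto_pos_of_walk_ne_zero hG hX hw
  have hone : ∀ N, (ENNReal.ofReal (walkInto G X' S))⁻¹ *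
      volume (Set.Icc 0 (walkInto G X' S) ∩ thresholds G S N) *
        resultProb G (Q N X') Set.univ = (ENNReal.ofReal (walkInto G X' S))⁻¹ *
      volume (Set.Icc 0 (walkInto G X' S) ∩ thresholds G S N) := by
    intro N
    by_cases hv : volume (Set.Icc 0 (walkInto G X' S) ∩ thresholds G S N) = 0
    · rw [hv, mul_zero, zero_mul]
    obtain ⟨hN, hX'⟩ := nextSet_eq_self_of_volume_ne_zero hG hv
    obtain ⟨h₁, h₂⟩ := hQ N X'
    simp only [hN] at h₁ h₂
    have : resultProb G (Q N X') Set.univ = 1 := by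
      by_cases hH : Halts G θ B left N (c + (vol G (symmDiff N S) + cut G S))
      · obtain ⟨out, hout⟩ := h₁ hH
        rw [hout, resultProb_ret (Set.mem_univ _)]
      · obtain ⟨D', hD', hQN⟩ := h₂ hH
        obtain ⟨l, rfl⟩ : ∃ l, left = l + 1 :=
          Nat.exists_eq_succ_of_ne_zero fun h0 => hH (.inl (.inl h0))
        rw [hQN]
        exact ih l (Nat.lt_succ_self l) hD' hX' _ _
    rw [this, mul_one]
  simp only [hone]
  rw [← Finset.mul_sum, sum_volume_thresholds,
    ENNReal.inv_mul_cancel (by simpa using hpos) ENNReal.ofReal_ne_top, mul_one]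

theorem isProbabilityMeasure_generateSample (hG : ∀ v, 0 < G.degree v) (x : V) (T B : ℕ) :
    IsProbabilityMeasure ((generateSample x T B).law G) := by
  obtain ⟨D, t, hD, hred, -⟩ := exists_reduces_generateSample hG x T B (S := fun _ => {x}) rfl
  refine ⟨?_⟩
  change resultProb G (generateSample x T B) Set.univ = 1
  rw [hred.resultProb]
  by_cases h : StopsAt G T B (fun _ => {x}) 0
  · rw [if_pos h, resultProb_ret (Set.mem_univ _)]
  · rw [if_neg h]
    obtain ⟨left, rfl⟩ := Nat.exists_eq_succ_of_ne_zero fun hT => h (.inr (.inl hT.symm))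
    have := hD.resultProb_steps_univ hG (theta G (left + 1)) B left (Finset.mem_singleton_self x)
      (G.degree x) [{x}]
    rwa [vol_singleton] at this

variable (G) in
/-- The results whose path is `S 0, …, S τ`. -/
def pathEvent (T B : ℕ) (S : ℕ → Finset V) : Set (Sample V) :=
  {s | s.path = (List.range (tau G T B S + 1)).map S}

theorem biasedKernel_nonneg (S S' : Finset V) : 0 ≤ biasedKernel G S S' := by
  rw [biasedKernel, espKernel]
  positivity

theorem vol_mul_biasedKernel {S : Finset V} (hS : 0 < vol G S) (S' : Finset V) :
    (vol G S : ℝ≥0∞) * ENNReal.ofReal (biasedKernel G S S') =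
      vol G S' * ENNReal.ofReal (espKernel G S S') := by
  have h : (vol G S : ℝ) ≠ 0 := by exact_mod_cast hS.ne'
  rw [← ENNReal.ofReal_natCast, ← ENNReal.ofReal_natCast,
    ← ENNReal.ofReal_mul (Nat.cast_nonneg _), ← ENNReal.ofReal_mul (Nat.cast_nonneg _),
    biasedKernel]
  congr 1
  field_simp

/-- If the state of the walk is stationary on `S t`, the rest of the path is generated with the
probabilities of the volume-biased process. -/
theorem StoresBoundary.sum_resultProb_steps (hG : ∀ v, 0 < G.degree v) {T B : ℕ} (hT : T ≠ 0)
    (x : V) (S : ℕ → Finset V) (left t : ℕ) (ht : t + (left + 1) = T) (hlt : t < tau G T B S)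
    {D : BoundarySet V} (h : StoresBoundary G D (S t)) :
    ∑ X ∈ S t, (G.degree X : ℝ≥0∞) * resultProb G (steps (theta G T) B (left + 1) D X
      (vol G (S t)) (cost G S t) (S t) ((List.range (t + 1)).map S)) (pathEvent G T B S) =
      vol G (S t) * ENNReal.ofReal
        (∏ j ∈ Finset.Ico t (tau G T B S), biasedKernel G (S j) (S (j + 1))) := by
  induction left using Nat.strong_induction_on generalizing t D with
  | _ left ih =>
  obtain ⟨Q, hQ, hprob⟩ := h.exists_resultProb_steps hG (theta G T) B left (cost G S t)
    ((List.range (t + 1)).map S)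
  -- A set of volume 0 has conductance 0 by the convention for division, so the path would have
  -- stopped at time `t`.
  have hvol : 0 < vol G (S t) := by
    by_contra! h0
    refine not_stopsAt_of_lt_tau hlt (.inl ?_)
    rw [conductance, Nat.le_zero.1 h0, Nat.cast_zero, div_zero]
    exact theta_pos hG x hT
  simp only [hprob]
  rw [sum_degree_mul_step hG (S t) fun N X' => resultProb G (Q N X') (pathEvent G T B S)]
  -- A successor other than `S (t + 1)` contributes nothing: either its kernel value is 0, or every
  -- possible outcome afterwards shows `N` at position `t + 1` of the path.
  have hother : ∀ N, N ≠ S (t + 1) → ∀ X' ∈ N, ENNReal.ofReal (espKernel G (S t) N) *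
      resultProb G (Q N X') (pathEvent G T B S) = 0 := by
    intro N hN X' hX'
    by_cases hv : volume (Set.Icc 0 (walkInto G X' (S t)) ∩ thresholds G (S t) N) = 0
    · rw [volume_thresholds, if_pos hX'] at hv
      rw [hv, zero_mul]
    have hNext := (nextSet_eq_self_of_volume_ne_zero hG hv).1
    obtain ⟨h₁, h₂⟩ := hQ N X'
    simp only [hNext] at h₁ h₂
    rw [← cost_update, halts_iff_stopsAt S N ht] at h₁ h₂
    rw [← map_range_update] at h₁ h₂
    rw [resultProb_eq_zero fun r hr hpath => ?_, mul_zero]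
    obtain ⟨S', m, hp, hS'⟩ : ∃ (S' : ℕ → Finset V) (m : ℕ),
        r.result.path = (List.range (m + 1)).map S' ∧ S' (t + 1) = N := by
      by_cases hend : StopsAt G T B (Function.update S (t + 1) N) (t + 1)
      · obtain ⟨out, hout⟩ := h₁ hend
        rw [hout] at hr
        exact ⟨_, t + 1, by rw [hr.eq_of_ret], Function.update_self _ _ _⟩
      · obtain ⟨D', hD', hQN⟩ := h₂ hend
        obtain ⟨l, rfl⟩ : ∃ l, left = l + 1 := Nat.exists_eq_succ_of_ne_zero fun h0 =>
          hend (.inr (.inl (by omega)))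
        rw [hQN] at hr
        have hself : Function.update S (t + 1) N (t + 1) = N := Function.update_self _ _ _
        obtain ⟨S', hS', hp, -⟩ := StoresBoundary.outcome_steps hG hT l X'
          (Function.update S (t + 1) N) (t + 1) (by omega) (by rwa [hself])
          (fun j hj => by
            rcases Nat.lt_or_eq_of_le hj with hj | rfl
            · have hj' := Nat.lt_succ_iff.1 hj
              exact (stopsAt_update S N T B hj').not.2 (not_stopsAt_of_lt_tau (hj'.trans_lt hlt))
            · exact hend) (by rw [hself]; exact hr)
        exact ⟨S', _, hp, (hS' (t + 1) le_rfl).trans hself⟩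
    exact hN (hS'.symm.trans (eq_of_map_range_eq (hp.symm.trans hpath) hlt))
  rw [Finset.sum_eq_single (S (t + 1))
    (fun N _ hN => Finset.sum_eq_zero fun X' hX' => by rw [hother N hN X' hX', mul_zero])
    (by simp)]
  have hprod : ENNReal.ofReal (∏ j ∈ Finset.Ico t (tau G T B S),
      biasedKernel G (S j) (S (j + 1))) = ENNReal.ofReal (biasedKernel G (S t) (S (t + 1))) *
      ENNReal.ofReal (∏ j ∈ Finset.Ico (t + 1) (tau G T B S),
        biasedKernel G (S j) (S (j + 1))) := by
    rw [Finset.prod_eq_prod_Ico_succ_bot hlt, ENNReal.ofReal_mul (biasedKernel_nonneg _ _)]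
  rw [hprod, ← mul_assoc, vol_mul_biasedKernel hvol]
  simp only [mul_left_comm _ (ENNReal.ofReal (espKernel G (S t) (S (t + 1))))]
  rw [← Finset.mul_sum, mul_comm (vol G (S (t + 1)) : ℝ≥0∞), mul_assoc]
  -- If the kernel vanishes, so do both sides. Otherwise `S (t + 1)` is reached through positive
  -- thresholds, unless it is empty, and the algorithm computes it correctly.
  by_cases hK : ENNReal.ofReal (espKernel G (S t) (S (t + 1))) = 0
  · rw [hK, zero_mul, zero_mul]
  congr 1
  rcases (S (t + 1)).eq_empty_or_nonempty with hemp | ⟨y, hy⟩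
  · rw [hemp, Finset.sum_empty, show vol G ∅ = 0 from rfl, Nat.cast_zero, zero_mul]
  have hNext : nextSet G (S t) (S (t + 1)) = S (t + 1) :=
    (nextSet_eq_self_of_volume_ne_zero hG (X := y) (by rwa [volume_thresholds, if_pos hy])).1
  have hcost := cost_update (G := G) S (S (t + 1)) t
  have hpath := map_range_update S (S (t + 1)) t
  have hhalts := halts_iff_stopsAt (G := G) S (S (t + 1)) (B := B) ht
  rw [Function.update_eq_self] at hcost hpath hhalts
  by_cases hend : StopsAt G T B S (t + 1)
  · have htau : tau G T B S = t + 1 := tau_eq_of_stopsAt hend fun j hj =>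
      not_stopsAt_of_lt_tau ((Nat.lt_succ_iff.1 hj).trans_lt hlt)
    rw [htau, Finset.Ico_self, Finset.prod_empty, ENNReal.ofReal_one, mul_one, vol,
      Nat.cast_sum]
    refine Finset.sum_congr rfl fun X' _ => ?_
    obtain ⟨out, hout⟩ := (hQ (S (t + 1)) X').1 (by
      simp only [hNext]; rwa [← hcost, hhalts])
    rw [hout, resultProb_ret, mul_one]
    rw [pathEvent, Set.mem_ofPred_eq, htau, hpath, hNext]
  · have hlt' : t + 1 < tau G T B S :=
      lt_of_le_of_ne hlt fun h' => hend (h' ▸ stopsAt_tau T B S)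
    obtain ⟨l, rfl⟩ : ∃ l, left = l + 1 := Nat.exists_eq_succ_of_ne_zero fun h0 =>
      hend (.inr (.inl (by omega)))
    obtain ⟨D', hD', hQN⟩ := (hQ (S (t + 1)) y).2 (by
      simp only [hNext]; rwa [← hcost, hhalts])
    simp only [hNext, ← hcost, ← hpath] at hD' hQN
    -- `hQN` was obtained from the particle `y` but is an equality of functions, so it rewrites the
    -- terms of all particles.
    rw [← ih l (Nat.lt_succ_self l) (t + 1) (by omega) hlt' hD', hQN]

theorem resultProb_generateSample (hG : ∀ v, 0 < G.degree v) (x : V) (T B : ℕ)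
    (S : ℕ → Finset V) (hS : S 0 = {x}) :
    resultProb G (generateSample x T B) (pathEvent G T B S) =
      ENNReal.ofReal (biasedPathProb G S (tau G T B S)) := by
  obtain ⟨D, t, hD, hred, -⟩ := exists_reduces_generateSample hG x T B hS
  rw [hred.resultProb]
  by_cases h : StopsAt G T B S 0
  · have htau : tau G T B S = 0 := tau_eq_of_stopsAt h (by simp)
    rw [if_pos h, resultProb_ret, htau]
    · simp [biasedPathProb]
    · rw [pathEvent, Set.mem_ofPred_eq, htau]
      simp [hS]
  · rw [if_neg h]
    have hT : T ≠ 0 := fun hT => h (.inr (.inl hT.symm))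
    obtain ⟨left, rfl⟩ := Nat.exists_eq_succ_of_ne_zero hT
    have hlt : 0 < tau G (left + 1) B S := Nat.pos_of_ne_zero fun h0 =>
      h (h0 ▸ stopsAt_tau (left + 1) B S)
    have key := StoresBoundary.sum_resultProb_steps hG hT x S left 0 (by omega) hlt
      (D := D) (by rwa [hS])
    have hcost : cost G S 0 = G.degree x := by simp [cost, hS, vol_singleton]
    -- On {x} the stationary average is a single term, whose weight d(x) cancels.
    rw [hcost, hS, Finset.sum_singleton, vol_singleton] at key
    have hd : (G.degree x : ℝ≥0∞) ≠ 0 := by exact_mod_cast (hG x).ne'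
    rw [ENNReal.mul_right_inj hd (ENNReal.natCast_ne_top _)] at key
    rw [biasedPathProb, Finset.range_eq_Ico, ← key]
    simp [hS]

/-- For n ≥ 2, n + 1 ≤ n² gives log₂(n + 1) ≤ 2 log₂ n. The factor 2 of the depth bound makes this 4
log₂ n, and the added 1 is at most log₂ n. -/
theorem maxDepth_add_one_le (hn : 1 < Fintype.card V) :
    (maxDepth V + 1 : ℝ) ≤ 5 / Real.log 2 * Real.log (Fintype.card V) := by
  have h2 : 0 < Real.log 2 := Real.log_pos one_lt_two
  have hn' : (2 : ℝ) ≤ Fintype.card V := by exact_mod_cast hn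
  have hlog : Real.log 2 ≤ Real.log (Fintype.card V) := Real.log_le_log two_pos hn'
  have hd : ((Fintype.card V + 1).log2 : ℝ) * Real.log 2 ≤ 2 * Real.log (Fintype.card V) := by
    have hpow : (2 : ℝ) ^ (Fintype.card V + 1).log2 ≤ (Fintype.card V : ℝ) ^ 2 := by
      have h₁ : 2 ^ (Fintype.card V + 1).log2 ≤ Fintype.card V + 1 :=
        Nat.log2_self_le (Nat.succ_ne_zero _)
      have h₂ : (2 : ℝ) ^ (Fintype.card V + 1).log2 ≤ Fintype.card V + 1 := by exact_mod_cast h₁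
      nlinarith
    have := Real.log_le_log (by positivity) hpow
    rwa [Real.log_pow, Real.log_pow, Nat.cast_ofNat] at this
  rw [maxDepth, div_mul_eq_mul_div, le_div_iff₀ h2]
  push_cast
  nlinarith

end Main

end EvoSet

theorem theorem3 :
    ∃ C : ℝ, 0 < C ∧
      ∀ (V : Type) [Fintype V] [LinearOrder V] (G : SimpleGraph V) [DecidableRel G.Adj],
        (∀ v : V, 0 < G.degree v) →
        ∀ (x : V) (T B : ℕ),
          MeasureTheory.IsProbabilityMeasure ((EvoSet.generateSample x T B).law G) ∧
          (∀ S : ℕ → Finset V, S 0 = {x} →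
            (EvoSet.generateSample x T B).law G
                {r | r.result.path = (List.range (EvoSet.tau G T B S + 1)).map S} =
              ENNReal.ofReal (EvoSet.biasedPathProb G S (EvoSet.tau G T B S))) ∧
          (∀ᵐ r ∂((EvoSet.generateSample x T B).law G),
            ∃ S : ℕ → Finset V, S 0 = {x} ∧
              r.result.path = (List.range (EvoSet.tau G T B S + 1)).map S ∧
              r.result.output.Nodup ∧
              r.result.output.toFinset = S (EvoSet.tau G T B S) ∧
              (r.time : ℝ) ≤ C * Real.log (Fintype.card V) *
                min (max 1 (B : ℝ)) (EvoSet.cost G S (EvoSet.tau G T B S))) := by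
  have h2 : 0 < Real.log 2 := Real.log_pos one_lt_two
  -- With H = `maxDepth V`, three times `timeFactor V` is 102H + 414, at most 414(H + 1).
  refine ⟨414 * (5 / Real.log 2), by positivity, ?_⟩
  intro V _ _ G _ hG x T B
  refine ⟨EvoSet.isProbabilityMeasure_generateSample hG x T B,
    fun S hS => EvoSet.resultProb_generateSample hG x T B S hS, ?_⟩
  filter_upwards [EvoSet.ae_outcome (G := G) (EvoSet.generateSample x T B)] with r hr
  obtain ⟨S, hS, hp, hnd, hout, htime⟩ := EvoSet.outcome_generateSample hG x T B hr
  refine ⟨S, hS, hp, hnd, hout, ?_⟩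
  have hdepth := EvoSet.maxDepth_add_one_le (EvoSet.one_lt_card hG x)
  have hfac : 3 * (EvoSet.timeFactor V : ℝ) ≤
      414 * (5 / Real.log 2) * Real.log (Fintype.card V) := by
    rw [EvoSet.timeFactor]
    push_cast
    nlinarith
  calc (r.time : ℝ) ≤ ((3 * EvoSet.timeFactor V *
        min (max 1 B) (EvoSet.cost G S (EvoSet.tau G T B S)) : ℕ) : ℝ) := by exact_mod_cast htime
    _ = 3 * (EvoSet.timeFactor V : ℝ) *
        min (max 1 (B : ℝ)) (EvoSet.cost G S (EvoSet.tau G T B S)) := by push_cast; rfl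
    _ ≤ _ := mul_le_mul_of_nonneg_right hfac (by positivity)
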